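/- All graphs $\Gamma$ are finite and simple. Let $\Gamma$ have girth $g$. For an edge $e$ of $\Gamma$ let $\epsilon(e)$ be the number of girth cycles (cycles of length $g$) of $\Gamma$ containing $e$. The signature of a vertex $v$ is the tuple of the numbers $\epsilon(e)$, for $e$ ranging over the edges incident with $v$, written in nondecreasing order (with multiplicities). $\Gamma$ is girth-regular if all its vertices have the same signature, which is then called the signature of $\Gamma$. Let $\Lambda$ be a finite loopless graph, possibly with parallel edges. An arc of $\Lambda$ is a pair $(v,e)$ with $v$ an end-vertex of the edge $e$; $v$ is its tail, and the two arcs of the same edge are inverse to each other. $\Lambda$ is $k$-regular if each vertex is the tail of exactly $k$ arcs. A dihedral scheme on $\Lambda$ is an irreflexive symmetric relation $\leftrightarrow$ on the arcs of $\Lambda$ such that the simple graph it defines on the set of arcs is $2$-regular and each of its connected components is the set of all arcs with tail $u$, for some vertex $u$. The truncation $\mathrm{Tr}(\Lambda,\leftrightarrow)$ is the simple graph whose vertices are the arcs of $\Lambda$, two arcs $s,t$ being adjacent if $s\leftrightarrow t$ or $s$ and $t$ are inverse to each other. **Theorem.** Let $\Gamma$ be a connected cubic girth-regular graph of girth $5$.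 Then either the signature of $\Gamma$ is $(0,1,1)$ and $\Gamma$ is isomorphic to $\mathrm{Tr}(\Lambda,\leftrightarrow)$ for some finite loopless $5$-regular graph $\Lambda$ (possibly with parallel edges) and some dihedral scheme $\leftrightarrow$ on $\Lambda$, or $\Gamma$ is isomorphic to the Petersen graph or to the dodecahedron graph. Moreover, the signature of $\Gamma$ is not $(2,3,3)$, and more generally it is never of the form $(a,b,c)$ with $c=3$. -/

import Mathlib

universe u

namespace SimpleGraph

/-- The set of girth cycles of `G`, that is, of the cycles of length `G.girth`; a cycle (as a
subgraph) is represented by its set of edges, which determines it. -/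
def girthCycles {V : Type u} (G : SimpleGraph V) : Set (Set (Sym2 V)) :=
  {C | ∃ (v : V) (p : G.Walk v v), p.IsCycle ∧ p.length = G.girth ∧ p.edgeSet = C}

/-- `ε(e)`: the number of girth cycles of `G` containing the edge `e`. -/
noncomputable def girthCycleCount {V : Type u} (G : SimpleGraph V) (e : Sym2 V) : ℕ :=
  {C ∈ G.girthCycles | e ∈ C}.ncard

/-- The signature of the vertex `v`: the numbers `ε(e)` for the edges `e` incident with `v`,
listed (with multiplicities) in nondecreasing order. -/
noncomputable def vertexSignature {V : Type u} [Fintype V] [DecidableEq V]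
    (G : SimpleGraph V) [DecidableRel G.Adj] (v : V) : List ℕ :=
  ((G.incidenceFinset v).val.map G.girthCycleCount).sort (· ≤ ·)

/-- `G` is girth-regular: all of its vertices have the same signature. -/
def IsGirthRegular {V : Type u} [Fintype V] [DecidableEq V]
    (G : SimpleGraph V) [DecidableRel G.Adj] : Prop :=
  ∀ v w : V, G.vertexSignature v = G.vertexSignature w

/-- `G` has signature `σ`: every vertex of `G` has signature `σ`. -/
def HasSignature {V : Type u} [Fintype V] [DecidableEq V]
    (G : SimpleGraph V) [DecidableRel G.Adj] (σ : List ℕ) : Prop :=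
  ∀ v : V, G.vertexSignature v = σ

/-- The generalised Petersen graph `GP(n, k)`: outer vertices `inl i` and inner vertices `inr i`
for `i ∈ ℤ/n`, with outer edges `inl i ~ inl (i + 1)`, spokes `inl i ~ inr i` and inner edges
`inr i ~ inr (i + k)`. -/
def generalizedPetersen (n k : ℕ) : SimpleGraph (ZMod n ⊕ ZMod n) :=
  SimpleGraph.fromRel fun x y =>
    match x, y with
    | .inl i, .inl j => j = i + 1
    | .inl i, .inr j => j = i
    | .inr i, .inr j => j = i + k
    | .inr _, .inl _ => False

/-- The Petersen graph, `GP(5, 2)`. -/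
abbrev petersenGraph : SimpleGraph (ZMod 5 ⊕ ZMod 5) := generalizedPetersen 5 2

/-- The dodecahedron graph, `GP(10, 2)`. Two opposite faces of the dodecahedron are the inner
pentagons on the even and on the odd indices; the other ten faces are the pentagons
`inr i, inl i, inl (i + 1), inl (i + 2), inr (i + 2)`. -/
abbrev dodecahedronGraph : SimpleGraph (ZMod 10 ⊕ ZMod 10) := generalizedPetersen 10 2

end SimpleGraph

namespace Graph

/-- An arc of a loopless multigraph `Λ`: a pair `(v, e)` where the vertex `v`, the tail of the arc,
is an end-vertex of the edge `e`. -/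
@[ext]
structure Arc {W E : Type u} (Λ : Graph W E) [Λ.Loopless] : Type u where
  /-- the tail of the arc -/
  tail : W
  /-- the underlying edge of the arc -/
  edge : E
  inc : Λ.Inc edge tail

/-- The set of arcs of `Λ` with tail `u`; its cardinality is the valence of `u`. -/
def out {W E : Type u} (Λ : Graph W E) [Λ.Loopless] (u : W) : Set Λ.Arc :=
  {s | s.tail = u}

/-- Every vertex of `Λ` has valence `k`. -/
def IsRegularOfValence {W E : Type u} (Λ : Graph W E) [Λ.Loopless] (k : ℕ) : Prop :=
  ∀ u ∈ Λ.vertexSet, (Λ.out u).encard = k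

/-- Two arcs are inverse to each other: they are the two different arcs of the same edge. -/
def Arc.IsInverse {W E : Type u} {Λ : Graph W E} [Λ.Loopless] (s t : Λ.Arc) : Prop :=
  s.edge = t.edge ∧ s.tail ≠ t.tail

/-- A dihedral scheme on `Λ`: an irreflexive symmetric relation on the arcs (here: the adjacency of
a simple graph on the arcs) which is 2-regular and such that each of its connected components
is the set of all arcs with tail `u`, for some vertex `u`. -/
structure DihedralScheme {W E : Type u} (Λ : Graph W E) [Λ.Loopless] : Type u where
  /-- the relation `↔`, as a simple graph -/
  rel : SimpleGraph Λ.Arc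
  two_regular : ∀ s : Λ.Arc, (rel.neighborSet s).encard = 2
  component_eq_out : ∀ c : rel.ConnectedComponent, ∃ u ∈ Λ.vertexSet, c.supp = Λ.out u

/-- The truncation `Tr(Λ, ↔)`: the simple graph on the arcs of `Λ` where `s` and `t` are adjacent
if `s ↔ t` or `s` and `t` are inverse to each other. -/
def DihedralScheme.truncation {W E : Type u} {Λ : Graph W E} [Λ.Loopless]
    (D : Λ.DihedralScheme) : SimpleGraph Λ.Arc where
  Adj s t := D.rel.Adj s t ∨ s.IsInverse t
  symm := ⟨fun _ _ h => h.imp (fun h => h.symm) fun h => ⟨h.1.symm, h.2.symm⟩⟩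
  loopless := ⟨fun _ h => h.elim (fun h => h.ne rfl) fun h => h.2 rfl⟩

end Graph

/-- `G` is isomorphic to the truncation of some finite loopless `k`-regular graph (possibly with
parallel edges) with respect to some dihedral scheme. -/
def SimpleGraph.IsTruncationOfRegular {V : Type u} (G : SimpleGraph V) (k : ℕ) : Prop :=
  ∃ (W E : Type u) (Λ : Graph W E) (_ : Λ.Loopless) (D : Λ.DihedralScheme),
    Λ.vertexSet.Finite ∧ Λ.edgeSet.Finite ∧ Λ.IsRegularOfValence k ∧
      Nonempty (G ≃g D.truncation)

/-! Let the three 2-paths centred at a vertex lie in x, y and z pentagons (`pentCount`). Without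
triangles and quadrangles each of these numbers is at most 2, and the three edges at the vertex have
counts x + y, x + z and y + z (`girthCycleCount_eqs`). Hence only ten signatures are arithmetically
possible (`HasType.cases`).

Five of them die by local arguments: (0,0,0), (0,2,2), (1,1,2), (1,2,3) and (2,3,3). This removes
every triple ending in 3. The remaining five determine the graph as follows.

In type (0,1,1) the edges in no pentagon form a perfect matching and the other edges form disjoint
pentagons. Contracting the pentagons gives a 5-regular multigraph whose arcs are the vertices of `G`
(`isTruncationOfRegular`).

If the largest entry is 4, the four pentagons on one edge produce ten vertices, and a further edge
in four pentagons supplies the two missing adjacencies of the Petersen graph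
(`nonempty_iso_petersen_of_type`).

In type (2,2,2) every 2-path lies in exactly one pentagon. Continuing pentagons along a strip
(`IsLadder`) is then forced, and the strip closes up after ten steps to the dodecahedron
(`nonempty_iso_dodecahedron`).

Both isomorphisms come from an injective homomorphism between cubic graphs, which is onto because
the target is connected (`nonempty_iso`). -/

namespace SimpleGraph

variable {V : Type u} {G : SimpleGraph V}

/-! ### Cubic graphs without short cycles, and pentagons through 2-paths -/

/-- The neighbours of `v` are the three distinct vertices `a`, `b`, `c`. -/
structure IsNbrs (G : SimpleGraph V) (v a b c : V) : Prop where
  ne₁₂ : a ≠ b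
  ne₁₃ : a ≠ c
  ne₂₃ : b ≠ c
  adj_iff : ∀ x, G.Adj v x ↔ x = a ∨ x = b ∨ x = c

/-- A cubic graph without triangles and quadrangles. -/
structure IsCubicNoShort (G : SimpleGraph V) : Prop where
  exists_isNbrs : ∀ v, ∃ a b c, G.IsNbrs v a b c
  not_adj_of_path : ∀ {a b c}, G.Adj a b → G.Adj b c → ¬ G.Adj a c
  eq_of_square : ∀ {x y a b}, G.Adj x a → G.Adj x b → G.Adj y a → G.Adj y b → a ≠ b → x = y

/-- `a` and `b` have a common neighbour. -/
def HaveCommon (G : SimpleGraph V) (a b : V) : Prop := ∃ w, G.Adj w a ∧ G.Adj w b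

/-- The number of pentagons through the path `a, u, v`, in a graph without short cycles. -/
noncomputable def pentCount (G : SimpleGraph V) (a u v : V) : ℕ :=
  {b | G.Adj v b ∧ b ≠ u ∧ G.HaveCommon b a}.ncard

lemma HaveCommon.symm {a b : V} (h : G.HaveCommon a b) : G.HaveCommon b a :=
  let ⟨w, h₁, h₂⟩ := h; ⟨w, h₂, h₁⟩

namespace IsNbrs

variable {v a b c : V}

lemma adj₁ (h : G.IsNbrs v a b c) : G.Adj v a := (h.adj_iff a).2 (by simp)
lemma adj₂ (h : G.IsNbrs v a b c) : G.Adj v b := (h.adj_iff b).2 (by simp)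
lemma adj₃ (h : G.IsNbrs v a b c) : G.Adj v c := (h.adj_iff c).2 (by simp)

lemma rotate (h : G.IsNbrs v a b c) : G.IsNbrs v b c a :=
  ⟨h.ne₂₃, h.ne₁₂.symm, h.ne₁₃.symm, fun x => by rw [h.adj_iff]; tauto⟩

lemma swap (h : G.IsNbrs v a b c) : G.IsNbrs v a c b :=
  ⟨h.ne₁₃, h.ne₁₂, h.ne₂₃.symm, fun x => by rw [h.adj_iff]; tauto⟩

/-- Three distinct neighbours of a cubic vertex are all of them. -/
lemma of_adj (h : G.IsNbrs v a b c) {x y z : V} (hx : G.Adj v x) (hy : G.Adj v y)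
    (hz : G.Adj v z) (hxy : x ≠ y) (hxz : x ≠ z) (hyz : y ≠ z) : G.IsNbrs v x y z := by
  refine ⟨hxy, hxz, hyz, fun w => ?_⟩
  rw [h.adj_iff] at *
  grind

end IsNbrs

namespace IsCubicNoShort

lemma nbrs_of_adj (hG : G.IsCubicNoShort) {v a : V} (h : G.Adj v a) :
    ∃ b c, G.IsNbrs v a b c := by
  obtain ⟨x, y, z, hn⟩ := hG.exists_isNbrs v
  rcases (hn.adj_iff a).1 h with rfl | rfl | rfl
  · exact ⟨_, _, hn⟩
  · exact ⟨_, _, hn.rotate⟩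
  · exact ⟨_, _, hn.rotate.rotate⟩

lemma isNbrs (hG : G.IsCubicNoShort) {v a b c : V} (ha : G.Adj v a) (hb : G.Adj v b)
    (hc : G.Adj v c) (hab : a ≠ b) (hac : a ≠ c) (hbc : b ≠ c) : G.IsNbrs v a b c :=
  let ⟨_, _, _, h⟩ := hG.exists_isNbrs v
  h.of_adj ha hb hc hab hac hbc

lemma nbrs_of_adj₂ (hG : G.IsCubicNoShort) {v a b : V} (ha : G.Adj v a) (hb : G.Adj v b)
    (hab : a ≠ b) : ∃ c, G.IsNbrs v a b c := by
  obtain ⟨x, y, hn⟩ := hG.nbrs_of_adj ha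
  rcases (hn.adj_iff b).1 hb with rfl | rfl | rfl
  · exact absurd rfl hab
  · exact ⟨_, hn⟩
  · exact ⟨_, hn.swap⟩

lemma finite_nbrs (hG : G.IsCubicNoShort) (v : V) : {b | G.Adj v b}.Finite := by
  obtain ⟨x, y, z, hn⟩ := hG.exists_isNbrs v
  refine Set.Finite.subset (s := {x, y, z}) (by simp) fun b hb => ?_
  simpa using (hn.adj_iff b).1 hb

lemma _root_.SimpleGraph.pentCount_eq [∀ a b, Decidable (G.HaveCommon a b)] {a u v p q : V}
    (hn : G.IsNbrs v u p q) :
    G.pentCount a u v = (if G.HaveCommon p a then 1 else 0) +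
      (if G.HaveCommon q a then 1 else 0) := by
  have : {b | G.Adj v b ∧ b ≠ u ∧ G.HaveCommon b a} =
      ((({p, q} : Set V)) ∩ {b | G.HaveCommon b a}) := by
    ext b
    simp only [Set.mem_ofPred_eq, hn.adj_iff, Set.mem_inter_iff, Set.mem_insert_iff,
      Set.mem_singleton_iff]
    have h1 := hn.ne₁₂
    have h2 := hn.ne₁₃
    grind
  rw [pentCount, this]
  by_cases h1 : G.HaveCommon p a <;> by_cases h2 : G.HaveCommon q a
  · rw [Set.inter_eq_left.2 (by rintro x (rfl | rfl) <;> assumption), Set.ncard_pair hn.ne₂₃]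
    simp [h1, h2]
  · rw [show ({p, q} : Set V) ∩ {b | G.HaveCommon b a} = {p} by
      ext x; simp; grind]
    simp [h1, h2]
  · rw [show ({p, q} : Set V) ∩ {b | G.HaveCommon b a} = {q} by
      ext x; simp; grind]
    simp [h1, h2]
  · rw [show ({p, q} : Set V) ∩ {b | G.HaveCommon b a} = ∅ by
      ext x; simp; grind]
    simp [h1, h2]

lemma pentCount_le (hG : G.IsCubicNoShort) {a u v : V} (h : G.Adj u v) :
    G.pentCount a u v ≤ 2 := by
  classical
  obtain ⟨p, q, hn⟩ := hG.nbrs_of_adj h.symm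
  rw [pentCount_eq hn]
  split_ifs <;> simp

/-- A pentagon `a, u, b, p, q` is counted by `p` from one side and by `q` from the other. The map
from `p` to `q` is injective: two values of `p` with the same `q` would form a quadrangle with `b`
and `q`. -/
lemma pentCount_symm (hG : G.IsCubicNoShort) {a u b : V} (ha : G.Adj u a) (hb : G.Adj u b)
    (hab : a ≠ b) : G.pentCount a u b = G.pentCount b u a := by
  have key : ∀ {a b}, G.Adj u a → G.Adj u b → a ≠ b → G.pentCount a u b ≤ G.pentCount b u a := by
    intro a b ha hb hab
    have hex : ∀ p, G.Adj b p ∧ p ≠ u ∧ G.HaveCommon p a →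
        ∃ q, G.Adj q p ∧ G.Adj a q ∧ q ≠ u ∧ G.HaveCommon q b := by
      rintro p ⟨h1, h2, w, h3, h4⟩
      refine ⟨w, h3, h4.symm, ?_, p, h3.symm, h1.symm⟩
      rintro rfl
      exact hG.not_adj_of_path hb h1 h3
    choose! f hf using hex
    refine Set.ncard_le_ncard_of_injOn f (fun p hp => (hf p hp).2) ?_
      ((hG.finite_nbrs a).subset fun x hx => hx.1)
    intro p hp p' hp' he
    by_contra hne
    have h1 := hf p hp
    have h2 := hf p' hp'
    rw [← he] at h2
    have := hG.eq_of_square h1.1 h2.1 hp.1 hp'.1 hne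
    exact hG.not_adj_of_path ha.symm hb (this ▸ h1.2.1)
  exact le_antisymm (key ha hb hab) (key hb ha hab.symm)

lemma pentCount_pos (hG : G.IsCubicNoShort) {a u v b : V} (hb : G.Adj v b) (hbu : b ≠ u)
    (h : G.HaveCommon a b) : 0 < G.pentCount a u v :=
  (Set.ncard_pos ((hG.finite_nbrs v).subset fun _ hx => hx.1)).2 ⟨b, hb, hbu, h.symm⟩

lemma _root_.SimpleGraph.exists_of_pentCount_pos {a u v : V} (h : 0 < G.pentCount a u v) :
    ∃ b, G.Adj v b ∧ b ≠ u ∧ G.HaveCommon a b := by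
  obtain ⟨b, h1, h2, h3⟩ := Set.nonempty_of_ncard_ne_zero 
    (s := {b | G.Adj v b ∧ b ≠ u ∧ G.HaveCommon b a}) h.ne'
  exact ⟨b, h1, h2, h3.symm⟩

lemma haveCommon_of_pentCount_eq_two (hG : G.IsCubicNoShort) {a u v b : V} (h : G.Adj v u)
    (h2 : G.pentCount a u v = 2) (hb : G.Adj v b) (hbu : b ≠ u) : G.HaveCommon a b := by
  classical
  obtain ⟨c, hn⟩ := hG.nbrs_of_adj₂ h hb hbu.symm
  rw [pentCount_eq hn] at h2
  by_contra hc
  rw [if_neg (fun h => hc h.symm)] at h2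
  split_ifs at h2 <;> simp at h2

lemma _root_.SimpleGraph.eq_of_pentCount_eq_one {a u v b b' : V}
    (h1 : G.pentCount a u v = 1) (hb : G.Adj v b) (hbu : b ≠ u) (h : G.HaveCommon a b)
    (hb' : G.Adj v b') (hbu' : b' ≠ u) (h' : G.HaveCommon a b') : b = b' := by
  obtain ⟨x, hx⟩ := Set.ncard_eq_one.1 h1
  have e : b ∈ ({x} : Set V) := hx ▸ (⟨hb, hbu, h.symm⟩ : _ ∧ _)
  have e' : b' ∈ ({x} : Set V) := hx ▸ (⟨hb', hbu', h'.symm⟩ : _ ∧ _)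
  rw [Set.mem_singleton_iff] at e e'
  rw [e, e']

end IsCubicNoShort

/-! ### Girth cycles as pentagons -/

lemma isCubicNoShort_of_girth [Fintype V] [DecidableEq V] [DecidableRel G.Adj]
    (hcubic : G.IsRegularOfDegree 3) (hgirth : G.girth = 5) : G.IsCubicNoShort where
  exists_isNbrs v := by
    have h := hcubic v
    rw [← card_neighborFinset_eq_degree, Finset.card_eq_three] at h
    obtain ⟨a, b, c, h1, h2, h3, h⟩ := h
    refine ⟨a, b, c, h1, h2, h3, fun x => ?_⟩
    rw [← mem_neighborFinset, h]
    simp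
  not_adj_of_path {a b c} h1 h2 h3 := by
    have : (Walk.cons h1 (Walk.cons h2 (Walk.cons h3.symm Walk.nil))).IsCycle := by
      have := h1.ne
      have := h2.ne
      have := h3.ne
      rw [Walk.cons_isCycle_iff]
      simp [Walk.cons_isPath_iff]
      grind
    have := girth_le_length this
    simp [hgirth] at this
  eq_of_square {x y a b} h1 h2 h3 h4 hab := by
    by_contra hxy
    have : (Walk.cons h1 (Walk.cons h3.symm (Walk.cons h4 (Walk.cons h2.symm Walk.nil)))).IsCycle := by
      have := h1.ne
      have := h2.ne
      have := h3.ne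
      have := h4.ne
      rw [Walk.cons_isCycle_iff]
      simp [Walk.cons_isPath_iff]
      grind
    have := girth_le_length this
    simp [hgirth] at this

/-- The edge set of the pentagon `u, v, b, w, a`. -/
def pentagonEdges (u v b w a : V) : Set (Sym2 V) :=
  {s(u, v), s(v, b), s(b, w), s(w, a), s(a, u)}

lemma pentagonEdges_rotate (u v b w a : V) :
    pentagonEdges u v b w a = pentagonEdges v b w a u := by
  ext e; simp only [pentagonEdges, Set.mem_insert_iff, Set.mem_singleton_iff]; tauto

lemma pentagonEdges_reverse (u v b w a : V) :
    pentagonEdges u v b w a = pentagonEdges v u a w b := by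
  ext e
  simp only [pentagonEdges, Set.mem_insert_iff, Set.mem_singleton_iff, Sym2.eq_swap (a := v) (b := u),
    Sym2.eq_swap (a := a) (b := u), Sym2.eq_swap (a := w) (b := a), Sym2.eq_swap (a := w) (b := b),
    Sym2.eq_swap (a := v) (b := b)]
  tauto

lemma exists_pentagonEdges_of_mem {x₀ x₁ x₂ x₃ x₄ u v : V} (h₀ : G.Adj x₀ x₁)
    (h₁ : G.Adj x₁ x₂) (h₂ : G.Adj x₂ x₃) (h₃ : G.Adj x₃ x₄) (h₄ : G.Adj x₄ x₀)
    (hd : [x₀, x₁, x₂, x₃, x₄].Nodup) (huv : s(u, v) ∈ pentagonEdges x₀ x₁ x₂ x₃ x₄) :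
    ∃ a b w, G.Adj u v ∧ G.Adj u a ∧ a ≠ v ∧ G.Adj v b ∧ b ≠ u ∧ G.Adj w a ∧ G.Adj w b ∧
        pentagonEdges u v b w a = pentagonEdges x₀ x₁ x₂ x₃ x₄ := by
  have key : ∀ {y₀ y₁ y₂ y₃ y₄ : V}, G.Adj y₀ y₁ → G.Adj y₁ y₂ → G.Adj y₂ y₃ → G.Adj y₃ y₄ →
      G.Adj y₄ y₀ → y₀ ≠ y₂ → y₁ ≠ y₄ → s(u, v) = s(y₀, y₁) →
      ∃ a b w, G.Adj u v ∧ G.Adj u a ∧ a ≠ v ∧ G.Adj v b ∧ b ≠ u ∧ G.Adj w a ∧ G.Adj w b ∧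
        pentagonEdges u v b w a = pentagonEdges y₀ y₁ y₂ y₃ y₄ := by
    intro y₀ y₁ y₂ y₃ y₄ h₀ h₁ h₂ h₃ h₄ hn hm h
    rcases Sym2.eq_iff.1 h with ⟨rfl, rfl⟩ | ⟨rfl, rfl⟩
    · exact ⟨y₄, y₂, y₃, h₀, h₄.symm, hm.symm, h₁, hn.symm, h₃, h₂.symm, rfl⟩
    · exact ⟨y₂, y₄, y₃, h₀.symm, h₁, hn.symm, h₄.symm, hm.symm, h₂.symm, h₃,
        pentagonEdges_reverse ..⟩
  simp only [List.nodup_cons, List.mem_cons, List.not_mem_nil, or_false, not_or] at hd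
  simp only [pentagonEdges, Set.mem_insert_iff, Set.mem_singleton_iff] at huv
  obtain ⟨⟨n01, n02, n03, n04⟩, ⟨n12, n13, n14⟩, ⟨n23, n24⟩, n34, -⟩ := hd
  rcases huv with h | h | h | h | h
  · exact key h₀ h₁ h₂ h₃ h₄ n02 n14 h
  · rw [pentagonEdges_rotate x₀]
    exact key h₁ h₂ h₃ h₄ h₀ n13 (Ne.symm n02) h
  · rw [pentagonEdges_rotate x₀, pentagonEdges_rotate x₁]
    exact key h₂ h₃ h₄ h₀ h₁ n24 (Ne.symm n13) h
  · rw [pentagonEdges_rotate x₀, pentagonEdges_rotate x₁, pentagonEdges_rotate x₂]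
    exact key h₃ h₄ h₀ h₁ h₂ (Ne.symm n03) (Ne.symm n24) h
  · rw [pentagonEdges_rotate x₀, pentagonEdges_rotate x₁, pentagonEdges_rotate x₂,
      pentagonEdges_rotate x₃]
    exact key h₄ h₀ h₁ h₂ h₃ (Ne.symm n14) n03 h

lemma mem_girthCycles_iff (hG : G.IsCubicNoShort) (hgirth : G.girth = 5) {C : Set (Sym2 V)}
    {u v : V} : (C ∈ G.girthCycles ∧ s(u, v) ∈ C) ↔
      ∃ a b w, G.Adj u v ∧ G.Adj u a ∧ a ≠ v ∧ G.Adj v b ∧ b ≠ u ∧ G.Adj w a ∧ G.Adj w b ∧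
        pentagonEdges u v b w a = C := by
  constructor
  · rintro ⟨⟨x, p, hp, hl, rfl⟩, huv⟩
    rw [hgirth] at hl
    match p, hp, hl, huv with
    | .cons (v := x₁) h₀ (.cons (v := x₂) h₁ (.cons (v := x₃) h₂ (.cons (v := x₄) h₃
        (.cons h₄ .nil)))), hp, _, huv =>
      have hd := hp.support_nodup
      simp only [Walk.support_cons, Walk.support_nil, List.tail_cons] at hd
      have he : (Walk.cons h₀ (.cons h₁ (.cons h₂ (.cons h₃ (.cons h₄ .nil))))).edgeSet =
          pentagonEdges x x₁ x₂ x₃ x₄ := by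
        ext e; simp [pentagonEdges]
      rw [he] at huv ⊢
      refine exists_pentagonEdges_of_mem h₀ h₁ h₂ h₃ h₄ ?_ huv
      simp only [List.nodup_cons, List.mem_cons, List.not_mem_nil, or_false, not_or] at hd ⊢
      grind
  · rintro ⟨a, b, w, h1, h2, h3, h4, h5, h6, h7, rfl⟩
    refine ⟨⟨u, .cons h1 (.cons h4 (.cons h7.symm (.cons h6 (.cons h2.symm .nil)))), ?_, by simp [hgirth], ?_⟩, ?_⟩
    · have := h1.ne
      have := h2.ne
      have := h4.ne
      have := h6.ne
      have := h7.ne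
      have : a ≠ b := by rintro rfl; exact hG.not_adj_of_path h1 h4 h2
      have : w ≠ u := by rintro rfl; exact hG.not_adj_of_path h1 h4 h7
      have : w ≠ v := by rintro rfl; exact hG.not_adj_of_path h1 h6 h2
      rw [Walk.cons_isCycle_iff]
      simp [Walk.cons_isPath_iff]
      grind
    · ext e; simp [pentagonEdges]
    · simp [pentagonEdges]

/-- The tuples `(a, b, w)` such that `u, v, b, w, a` is a pentagon. -/
def pentagonTuples (G : SimpleGraph V) (u v : V) : Set (V × V × V) :=
  {t | G.Adj u t.1 ∧ t.1 ≠ v ∧ G.Adj v t.2.1 ∧ t.2.1 ≠ u ∧ G.Adj t.2.2 t.1 ∧ G.Adj t.2.2 t.2.1}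

/-- The edge set recovers the tuple: `a` and `b` are read off from the second edges at `u` and at
`v`, and `w` is the only common neighbour of `a` and `b`, as there are no quadrangles. -/
lemma girthCycleCount_eq_ncard (hG : G.IsCubicNoShort) (hgirth : G.girth = 5) {u v : V}
    (h : G.Adj u v) : G.girthCycleCount s(u, v) = (G.pentagonTuples u v).ncard := by
  have himg : {C ∈ G.girthCycles | s(u, v) ∈ C} =
      (fun t : V × V × V => pentagonEdges u v t.2.1 t.2.2 t.1) '' G.pentagonTuples u v := by
    ext C
    refine (mem_girthCycles_iff hG hgirth).trans ?_
    simp only [pentagonTuples, Set.mem_image, Set.mem_ofPred_eq, Prod.exists]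
    grind
  rw [girthCycleCount, himg, Set.InjOn.ncard_image]
  rintro ⟨a, b, w⟩ ⟨h1, h2, h3, h4, h5, h6⟩ ⟨a', b', w'⟩ ⟨g1, g2, g3, g4, g5, g6⟩ he
  dsimp only at *
  have n1 : ∀ {w a}, G.Adj u a → G.Adj w a → w ≠ v := by
    rintro w a k1 k2 rfl; exact hG.not_adj_of_path h k2 k1
  have n2 : ∀ {w b}, G.Adj v b → G.Adj w b → w ≠ u := by
    rintro w b k1 k2 rfl; exact hG.not_adj_of_path h k1 k2
  have e1 : s(u, a) ∈ pentagonEdges u v b' w' a' := by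
    rw [← he]; simp [pentagonEdges, Sym2.eq_swap]
  have e2 : s(v, b) ∈ pentagonEdges u v b' w' a' := by
    rw [← he]; simp [pentagonEdges]
  have m1 := n1 h1 h5
  have m1' := n1 g1 g5
  have m2 := n2 h3 h6
  have m2' := n2 g3 g6
  have hne := h.ne
  have q1 := h1.ne
  have q2 := h3.ne
  have q3 := g1.ne
  have q4 := g3.ne
  have ea : a = a' := by
    simp only [pentagonEdges, Set.mem_insert_iff, Set.mem_singleton_iff, Sym2.eq_iff] at e1
    clear himg e2
    grind
  have eb : b = b' := by
    simp only [pentagonEdges, Set.mem_insert_iff, Set.mem_singleton_iff, Sym2.eq_iff] at e2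
    clear himg e1
    grind
  subst ea eb
  have hab : a ≠ b := by rintro rfl; exact hG.not_adj_of_path h h3 h1
  rw [hG.eq_of_square h5 h6 g5 g6 hab]

/-- A pentagon through `uv` leaves `u` by exactly one of the other two edges. -/
lemma girthCycleCount_eq (hG : G.IsCubicNoShort) (hgirth : G.girth = 5) {u v a a' : V}
    (hn : G.IsNbrs u v a a') :
    G.girthCycleCount s(u, v) = G.pentCount a u v + G.pentCount a' u v := by
  rw [girthCycleCount_eq_ncard hG hgirth hn.adj₁]
  have hfin : ∀ x, {b | G.Adj v b ∧ b ≠ u ∧ G.HaveCommon b x}.Finite := fun x =>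
    (hG.finite_nbrs v).subset fun _ h => h.1
  rw [pentCount, pentCount,
    ← Set.ncard_image_of_injective (f := fun b => (a, b)) {b | G.Adj v b ∧ b ≠ u ∧ G.HaveCommon b a} (Prod.mk_right_injective a),
    ← Set.ncard_image_of_injective (f := fun b => (a', b)) {b | G.Adj v b ∧ b ≠ u ∧ G.HaveCommon b a'} (Prod.mk_right_injective a'),
    ← Set.ncard_union_eq _ ((hfin a).image _) ((hfin a').image _)]
  · refine Set.ncard_congr (fun t _ => (t.1, t.2.1)) ?_ ?_ ?_
    · rintro ⟨x, b, w⟩ ⟨h1, h2, h3, h4, h5, h6⟩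
      dsimp only at *
      rcases (hn.adj_iff x).1 h1 with rfl | rfl | rfl
      · exact absurd rfl h2
      · exact Or.inl ⟨b, ⟨h3, h4, w, h6, h5⟩, rfl⟩
      · exact Or.inr ⟨b, ⟨h3, h4, w, h6, h5⟩, rfl⟩
    · rintro ⟨x, b, w⟩ ⟨x', b', w'⟩ ⟨h1, h2, h3, h4, h5, h6⟩ ⟨g1, g2, g3, g4, g5, g6⟩ he
      dsimp only at *
      obtain ⟨rfl, rfl⟩ := Prod.mk.inj he
      have hab : x ≠ b := by rintro rfl; exact hG.not_adj_of_path hn.adj₁ h3 h1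
      rw [hG.eq_of_square h5 h6 g5 g6 hab]
    · rintro t (⟨b, ⟨h1, h2, w, h3, h4⟩, rfl⟩ | ⟨b, ⟨h1, h2, w, h3, h4⟩, rfl⟩)
      · exact ⟨(a, b, w), ⟨hn.adj₂, hn.ne₁₂.symm, h1, h2, h4, h3⟩, rfl⟩
      · exact ⟨(a', b, w), ⟨hn.adj₃, hn.ne₁₃.symm, h1, h2, h4, h3⟩, rfl⟩
  · rw [Set.disjoint_left]
    rintro _ ⟨b, _, rfl⟩ ⟨b', _, he⟩
    exact hn.ne₂₃ (Prod.mk.inj he).1.symm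

/-! ### Signatures and the ten arithmetic candidates -/

/-- The three edges at every vertex lie in `α`, `β` and `γ` girth cycles. -/
def HasType (G : SimpleGraph V) (α β γ : ℕ) : Prop :=
  ∀ u, ∃ a b c, G.IsNbrs u a b c ∧ G.girthCycleCount s(u, a) = α ∧
    G.girthCycleCount s(u, b) = β ∧ G.girthCycleCount s(u, c) = γ

section Signature

variable [Fintype V] [DecidableEq V] [DecidableRel G.Adj]

lemma coe_vertexSignature {v a b c : V} (hn : G.IsNbrs v a b c) :
    (G.vertexSignature v : Multiset ℕ) = {G.girthCycleCount s(v, a), G.girthCycleCount s(v, b),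
      G.girthCycleCount s(v, c)} := by
  have : G.incidenceFinset v = {s(v, a), s(v, b), s(v, c)} := by
    ext e
    induction e with
    | _ x y =>
      simp only [mem_incidenceFinset, mk'_mem_incidenceSet_iff, Finset.mem_insert,
        Finset.mem_singleton, Sym2.eq_iff]
      have h1 := hn.adj_iff
      have h2 := hn.adj₁
      have h3 := hn.adj₂
      have h4 := hn.adj₃
      constructor
      · rintro ⟨h, rfl | rfl⟩
        · have := (h1 y).1 h
          tauto
        · have := (h1 x).1 h.symm
          tauto
      · rintro ((⟨rfl, rfl⟩ | ⟨rfl, rfl⟩) | (⟨rfl, rfl⟩ | ⟨rfl, rfl⟩) | (⟨rfl, rfl⟩ | ⟨rfl, rfl⟩)) <;>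
          exact ⟨by first | assumption | (apply Adj.symm; assumption), by simp⟩
  have hne := hn.ne₁₂
  have hne' := hn.ne₁₃
  have hne'' := hn.ne₂₃
  rw [vertexSignature, Multiset.sort_eq, this, Finset.insert_val_of_notMem,
    Finset.insert_val_of_notMem]
  · simp
  · simp only [Finset.mem_singleton, Sym2.eq_iff]
    grind
  · simp only [Finset.mem_insert, Finset.mem_singleton, Sym2.eq_iff]
    grind

lemma HasSignature.hasType (hG : G.IsCubicNoShort) {α β γ : ℕ}
    (h : G.HasSignature [α, β, γ]) : G.HasType α β γ := by
  intro u
  obtain ⟨a, b, c, hn⟩ := hG.exists_isNbrs u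
  have h1 := coe_vertexSignature hn
  rw [h u] at h1
  have h2 : [α, β, γ].Perm [G.girthCycleCount s(u, a), G.girthCycleCount s(u, b),
      G.girthCycleCount s(u, c)] := Multiset.coe_eq_coe.1 h1
  have h3 := List.mem_permutations.2 h2
  simp [List.permutations, List.permutationsAux, List.permutationsAux.rec, List.permutationsAux2] at h3
  -- One case for each ordering of the three neighbours.
  rcases h3 with h | h | h | h | h | h
  · exact ⟨_, _, _, hn, h.1.symm, h.2.1.symm, h.2.2.symm⟩
  · exact ⟨_, _, _, hn.swap.rotate.rotate, h.1.symm, h.2.1.symm, h.2.2.symm⟩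
  · exact ⟨_, _, _, hn.rotate.rotate.swap, h.1.symm, h.2.1.symm, h.2.2.symm⟩
  · exact ⟨_, _, _, hn.rotate, h.1.symm, h.2.1.symm, h.2.2.symm⟩
  · exact ⟨_, _, _, hn.rotate.rotate, h.1.symm, h.2.1.symm, h.2.2.symm⟩
  · exact ⟨_, _, _, hn.swap, h.1.symm, h.2.1.symm, h.2.2.symm⟩

lemma exists_hasSignature [Nonempty V] (hG : G.IsCubicNoShort) (hreg : G.IsGirthRegular) :
    ∃ α β γ, α ≤ β ∧ β ≤ γ ∧ G.HasSignature [α, β, γ] := by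
  obtain ⟨v⟩ := ‹Nonempty V›
  obtain ⟨a, b, c, hn⟩ := hG.exists_isNbrs v
  have h1 := congrArg Multiset.card (coe_vertexSignature hn)
  simp only [Multiset.coe_card, Multiset.insert_eq_cons, Multiset.card_cons,
    Multiset.card_singleton] at h1
  obtain ⟨α, β, γ, h⟩ := List.length_eq_three.1 h1
  have hs : (G.vertexSignature v).Pairwise (· ≤ ·) := Multiset.pairwise_sort _ _
  rw [h] at hs
  simp at hs
  exact ⟨α, β, γ, hs.1.1, hs.2, fun w => (hreg w v).trans h⟩

end Signature

/-- The pentagons through the edges at a vertex, counted through the paths centred there. -/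
lemma IsCubicNoShort.girthCycleCount_eqs (hG : G.IsCubicNoShort) (hgirth : G.girth = 5)
    {u a b c : V} (hn : G.IsNbrs u a b c) :
    G.girthCycleCount s(u, a) = G.pentCount a u b + G.pentCount a u c ∧
    G.girthCycleCount s(u, b) = G.pentCount a u b + G.pentCount b u c ∧
    G.girthCycleCount s(u, c) = G.pentCount a u c + G.pentCount b u c := by
  rw [girthCycleCount_eq hG hgirth hn, girthCycleCount_eq hG hgirth hn.rotate,
    girthCycleCount_eq hG hgirth hn.rotate.rotate,
    hG.pentCount_symm hn.adj₂ hn.adj₁ hn.ne₁₂.symm, hG.pentCount_symm hn.adj₃ hn.adj₁ hn.ne₁₃.symm,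
    hG.pentCount_symm hn.adj₃ hn.adj₂ hn.ne₂₃.symm]
  simp only [true_and]
  exact ⟨by ring, trivial⟩

/-- With counts x, y, z for the 2-paths, the ordering of x + y, x + z, y + z amounts to x ≤ y ≤ z.
There are ten such triples with entries at most 2. -/
lemma HasType.cases [Nonempty V] (hG : G.IsCubicNoShort) (hgirth : G.girth = 5) {α β γ : ℕ}
    (h : G.HasType α β γ) (h1 : α ≤ β) (h2 : β ≤ γ) :
    (α, β, γ) ∈ [(0, 0, 0), (0, 1, 1), (0, 2, 2), (1, 1, 2), (1, 2, 3), (2, 2, 4), (2, 2, 2),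
      (2, 3, 3), (3, 3, 4), (4, 4, 4)] := by
  obtain ⟨v⟩ := ‹Nonempty V›
  obtain ⟨a, b, c, hn, f1, f2, f3⟩ := h v
  obtain ⟨e1, e2, e3⟩ := hG.girthCycleCount_eqs hgirth hn
  have b1 := hG.pentCount_le (a := a) hn.adj₂
  have b2 := hG.pentCount_le (a := a) hn.adj₃
  have b3 := hG.pentCount_le (a := b) hn.adj₃
  obtain rfl := f1.symm.trans e1
  obtain rfl := f2.symm.trans e2
  obtain rfl := f3.symm.trans e3
  clear h f1 f2 f3 e1 e2 e3
  generalize G.pentCount a v b = x at *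
  generalize G.pentCount a v c = y at *
  generalize G.pentCount b v c = z at *
  interval_cases x <;> interval_cases y <;> interval_cases z <;> simp at h1 h2 ⊢

/-! ### Exclusion of (0,0,0), (0,2,2), (1,2,3) and (1,1,2) -/

/-- Type `(0, 0, 0)` is impossible: there is a girth cycle. -/
lemma not_hasType_zero (hG : G.IsCubicNoShort) (hgirth : G.girth = 5) : ¬ G.HasType 0 0 0 := by
  intro h
  obtain ⟨v, p, hp, hl⟩ := exists_girth_eq_length.2 (fun h => by
    rw [girth_eq_zero.2 h] at hgirth; omega : ¬ G.IsAcyclic)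
  cases p with
  | nil => simp at hp
  | cons hadj q =>
    rename_i x
    obtain ⟨a, b, w, h1, h2, h3, h4, h5, h6, h7, _⟩ :=
      (mem_girthCycles_iff hG hgirth).1 (⟨⟨v, _, hp, hl.symm, rfl⟩, by simp⟩ :
        (Walk.cons hadj q).edgeSet ∈ G.girthCycles ∧ s(v, x) ∈ (Walk.cons hadj q).edgeSet)
    have hpos : 0 < G.pentCount a v x := hG.pentCount_pos h4 h5 ⟨w, h6, h7⟩
    obtain ⟨c, hn⟩ := hG.nbrs_of_adj₂ h1 h2 h3.symm
    have e := hG.girthCycleCount_eqs hgirth hn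
    obtain ⟨a', b', c', hn', e1, e2, e3⟩ := h v
    have : G.girthCycleCount s(v, x) = 0 := by
      rcases (hn'.adj_iff x).1 h1 with rfl | rfl | rfl <;> assumption
    rw [hG.pentCount_symm h2 h1 h3] at hpos
    omega

/-- The two pentagons on `x, u, y` use both continuations at `y`, so one of them runs through `u, y,
q`. -/
lemma IsCubicNoShort.pentCount_pos_of_eq_two (hG : G.IsCubicNoShort) {x u y q : V}
    (hx : G.Adj u x) (hy : G.Adj u y) (hxy : x ≠ y) (h2 : G.pentCount x u y = 2)
    (hq : G.Adj y q) (hqu : q ≠ u) : 0 < G.pentCount u y q := by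
  have := hG.pentCount_pos hx hxy (hG.haveCommon_of_pentCount_eq_two hy.symm h2 hq hqu).symm
  rwa [hG.pentCount_symm hq hy.symm hqu] at this

/-- The two 2-edges at `u` form a path in two pentagons. One of these continues along the 0-edge at
`c`, which lies in none. -/
lemma not_hasType_zero_two_two (hG : G.IsCubicNoShort) (hgirth : G.girth = 5) [Nonempty V] :
    ¬ G.HasType 0 2 2 := by
  intro h
  obtain ⟨u⟩ := ‹Nonempty V›
  obtain ⟨a, b, c, hn, e1, e2, e3⟩ := h u
  have e := hG.girthCycleCount_eqs hgirth hn
  obtain ⟨a', b', c', hn', e1', e2', e3'⟩ := h c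
  have e' := hG.girthCycleCount_eqs hgirth hn'
  have hX : G.pentCount b u c = 2 := by omega
  rw [Sym2.eq_swap] at e3
  have hu : a' ≠ u := by rintro rfl; omega
  have hpos := hG.pentCount_pos_of_eq_two hn.adj₂ hn.adj₃ hn.ne₂₃ hX hn'.adj₁ hu
  rw [hG.pentCount_symm hn.adj₃.symm hn'.adj₁ hu.symm] at hpos
  rcases (hn'.adj_iff u).1 hn.adj₃.symm with rfl | rfl | rfl
  · exact hu rfl
  · omega
  · omega

/-- The 2-edge and the 3-edge at a vertex form a path in two pentagons, the 1-edge and the 2-edge a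
path in none. Following the former across the 2-edge `ub` puts the latter path at `b` into a
pentagon. -/
lemma not_hasType_one_two_three (hG : G.IsCubicNoShort) (hgirth : G.girth = 5) [Nonempty V] :
    ¬ G.HasType 1 2 3 := by
  intro h
  obtain ⟨u⟩ := ‹Nonempty V›
  obtain ⟨a, b, c, hn, e1, e2, e3⟩ := h u
  have e := hG.girthCycleCount_eqs hgirth hn
  obtain ⟨a', b', c', hn', e1', e2', e3'⟩ := h b
  have e' := hG.girthCycleCount_eqs hgirth hn'
  have hX : G.pentCount c u b = 2 := by
    rw [hG.pentCount_symm hn.adj₃ hn.adj₂ hn.ne₂₃.symm]; omega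
  rw [Sym2.eq_swap] at e2
  have hu : a' ≠ u := by rintro rfl; omega
  have hpos := hG.pentCount_pos_of_eq_two hn.adj₃ hn.adj₂ hn.ne₂₃.symm hX hn'.adj₁ hu
  rw [hG.pentCount_symm hn.adj₂.symm hn'.adj₁ hu.symm] at hpos
  rcases (hn'.adj_iff u).1 hn.adj₂.symm with rfl | rfl | rfl
  · exact hu rfl
  · omega
  · omega

/-- The two 1-edges at a vertex lie in no common pentagon, so 1-edges and 2-edges would alternate
around a cycle of odd length. -/
lemma not_hasType_one_one_two (hG : G.IsCubicNoShort) (hgirth : G.girth = 5) [Nonempty V] :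
    ¬ G.HasType 1 1 2 := by
  intro h
  have key : ∀ {x v y : V}, G.Adj x v → G.Adj v y → x ≠ y → 0 < G.pentCount x v y →
      G.girthCycleCount s(x, v) + G.girthCycleCount s(v, y) = 3 := by
    intro x v y hx hy hxy hpos
    have hpos' := hpos
    rw [hG.pentCount_symm hx.symm hy hxy] at hpos'
    obtain ⟨a, b, c, hn, e1, e2, e3⟩ := h v
    have e := hG.girthCycleCount_eqs hgirth hn
    rw [Sym2.eq_swap]
    rcases (hn.adj_iff x).1 hx.symm with rfl | rfl | rfl <;>
    rcases (hn.adj_iff y).1 hy with rfl | rfl | rfl <;>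
    first | exact absurd rfl hxy | omega
  obtain ⟨u⟩ := ‹Nonempty V›
  obtain ⟨a, b, c, hn, e1, e2, e3⟩ := h u
  have e := hG.girthCycleCount_eqs hgirth hn
  have hpos : 0 < G.pentCount a u c := by omega
  obtain ⟨p, hp, hpu, w, hw, hw'⟩ := exists_of_pentCount_pos hpos
  have hua := hn.adj₁
  have huc := hn.adj₃
  have hwu : w ≠ u := by rintro rfl; exact hG.not_adj_of_path huc hp hw'
  have hwc : w ≠ c := by rintro rfl; exact hG.not_adj_of_path hua hw.symm huc
  have hap : a ≠ p := by rintro rfl; exact hG.not_adj_of_path huc hp hua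
  have k1 := key hua.symm huc hn.ne₁₃ hpos
  have k2 := key huc hp hpu.symm (hG.pentCount_pos hw'.symm hwc ⟨a, hua.symm, hw.symm⟩)
  have k3 := key hp hw'.symm hwc.symm (hG.pentCount_pos hw hap ⟨u, huc, hua⟩)
  have k4 := key hw'.symm hw hap.symm (hG.pentCount_pos hua.symm hwu.symm ⟨c, hp, huc.symm⟩)
  have k5 := key hw hua.symm hwu (hG.pentCount_pos huc hn.ne₁₃.symm ⟨p, hw'.symm, hp.symm⟩)
  -- Adding the five equations gives an even number equal to 15.
  omega

/-! ### Exclusion of (2,3,3): the 2-edges form a perfect matching of partners -/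

section TwoThreeThree

lemma HasType.exists_isNbrs_eq_two (h : G.HasType 2 3 3) (v : V) :
    ∃ m x y, G.IsNbrs v m x y ∧ G.girthCycleCount s(v, m) = 2 :=
  let ⟨a, b, c, hn, h1, _, _⟩ := h v
  ⟨a, b, c, hn, h1⟩

lemma HasType.eq_of_eq_two (h : G.HasType 2 3 3) {v m x : V} (hm : G.Adj v m) (hx : G.Adj v x)
    (h1 : G.girthCycleCount s(v, m) = 2) (h2 : G.girthCycleCount s(v, x) = 2) : m = x := by
  obtain ⟨a, b, c, hn, e1, e2, e3⟩ := h v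
  rcases (hn.adj_iff m).1 hm with rfl | rfl | rfl <;>
  rcases (hn.adj_iff x).1 hx with rfl | rfl | rfl <;> first | rfl | omega

lemma HasType.eq_two_or_eq_three (h : G.HasType 2 3 3) {v x : V} (hx : G.Adj v x) :
    G.girthCycleCount s(v, x) = 2 ∨ G.girthCycleCount s(v, x) = 3 := by
  obtain ⟨a, b, c, hn, e1, e2, e3⟩ := h v
  rcases (hn.adj_iff x).1 hx with rfl | rfl | rfl <;> simp [*]

lemma HasType.eq_three_of_ne (h : G.HasType 2 3 3) {v m x : V} (hm : G.Adj v m)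
    (hx : G.Adj v x) (h1 : G.girthCycleCount s(v, m) = 2) (hne : x ≠ m) :
    G.girthCycleCount s(v, x) = 3 :=
  (h.eq_two_or_eq_three hx).resolve_left fun h2 => hne (h.eq_of_eq_two hm hx h1 h2).symm

lemma HasType.pentCount_of_isNbrs (hG : G.IsCubicNoShort) (hgirth : G.girth = 5)
    (h : G.HasType 2 3 3) {v m x y : V} (hn : G.IsNbrs v m x y)
    (h1 : G.girthCycleCount s(v, m) = 2) :
    G.pentCount m v x = 1 ∧ G.pentCount m v y = 1 ∧ G.pentCount x v y = 2 := by
  have e := hG.girthCycleCount_eqs hgirth hn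
  have h2 := h.eq_three_of_ne hn.adj₁ hn.adj₂ h1 hn.ne₁₂.symm
  have h3 := h.eq_three_of_ne hn.adj₁ hn.adj₃ h1 hn.ne₁₃.symm
  omega

/-- The partners of the ends of an edge in three pentagons have no common neighbour. -/
lemma HasType.not_haveCommon (hG : G.IsCubicNoShort) (hgirth : G.girth = 5)
    (h : G.HasType 2 3 3) {u v m n : V} (huv : G.Adj u v) (hum : G.Adj u m) (hvn : G.Adj v n)
    (hm : G.girthCycleCount s(u, m) = 2) (hn : G.girthCycleCount s(v, n) = 2)
    (hmv : m ≠ v) (hnu : n ≠ u) : ¬ G.HaveCommon m n := by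
  intro hc
  obtain ⟨x, hx⟩ := hG.nbrs_of_adj₂ hum huv hmv
  obtain ⟨y, hy⟩ := hG.nbrs_of_adj₂ hvn huv.symm hnu
  have h1 := (h.pentCount_of_isNbrs hG hgirth hx hm).1
  have h2 := (h.pentCount_of_isNbrs hG hgirth hy hn).2.2
  rw [hG.pentCount_symm hy.adj₂ hy.adj₃ hy.ne₂₃] at h2
  -- The path `u, v, y` of two 3-edges lies in two pentagons, so one of them extends it to `m`. That
  -- is the only pentagon on `m, u, v`, and it avoids `n`.
  have h3 := hG.haveCommon_of_pentCount_eq_two huv h2 hum hmv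
  exact hy.ne₁₃ (eq_of_pentCount_eq_one h1 hvn hnu hc hy.adj₃ hy.ne₂₃.symm h3.symm)

lemma not_hasType_two_three_three (hG : G.IsCubicNoShort) (hgirth : G.girth = 5) [Nonempty V] :
    ¬ G.HasType 2 3 3 := by
  intro h
  obtain ⟨u⟩ := ‹Nonempty V›
  obtain ⟨m, v, c, hn, e1⟩ := h.exists_isNbrs_eq_two u
  have hpos : 0 < G.pentCount m u v := by rw [(h.pentCount_of_isNbrs hG hgirth hn e1).1]; simp
  obtain ⟨v', hv', hvu, z, hz, hz'⟩ := exists_of_pentCount_pos hpos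
  have huv := hn.adj₂
  have hum := hn.adj₁
  have e1' : G.girthCycleCount s(m, u) = 2 := by rwa [Sym2.eq_swap]
  obtain ⟨n, _, _, hnv, en⟩ := h.exists_isNbrs_eq_two v
  have hvn := hnv.adj₁
  have hnu : n ≠ u := by
    rintro rfl
    rw [Sym2.eq_swap] at en
    exact hn.ne₁₂ (h.eq_of_eq_two hum huv e1 en)
  have hv'n : v' ≠ n := by
    rintro rfl
    exact h.not_haveCommon hG hgirth huv hum hvn e1 en hn.ne₁₂ hnu ⟨z, hz, hz'⟩
  have hzu : z ≠ u := by rintro rfl; exact hG.not_adj_of_path huv hv' hz'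
  have hmv' : m ≠ v' := by rintro rfl; exact hG.not_adj_of_path huv hv' hum
  have hzv : z ≠ v := by rintro rfl; exact hG.not_adj_of_path hum hz.symm huv
  obtain ⟨k, _, _, hkz, ek⟩ := h.exists_isNbrs_eq_two z
  have hzk := hkz.adj₁
  have hkm : k ≠ m := by
    rintro rfl
    rw [Sym2.eq_swap] at ek
    exact hzu (h.eq_of_eq_two hzk.symm hum.symm ek e1')
  have hkv' : k ≠ v' := by
    rintro rfl
    exact h.not_haveCommon hG hgirth hz hzk hum.symm ek e1' hkm hzu.symm ⟨v, hv', huv.symm⟩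
  have hkv : k ≠ v := by
    rintro rfl
    exact hG.not_adj_of_path hv' hz'.symm hzk.symm
  -- The partners of `v` and `z` are `n` and `k`, so `v'` is matched to neither and the path `z, v',
  -- v` consists of two 3-edges.
  have hX : G.pentCount z v' v = 2 := by
    obtain ⟨t, _, _, ht, et⟩ := h.exists_isNbrs_eq_two v'
    have htv : t ≠ v := by
      rintro rfl
      rw [Sym2.eq_swap] at et
      exact hv'n (h.eq_of_eq_two hvn hv' en et).symm
    have htz : t ≠ z := by
      rintro rfl
      rw [Sym2.eq_swap] at et
      exact hkv' (h.eq_of_eq_two hzk hz' ek et)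
    exact (h.pentCount_of_isNbrs hG hgirth (hG.isNbrs ht.adj₁ hz'.symm hv'.symm htz htv hzv)
      et).2.2
  obtain ⟨q, hq, hq'⟩ := hG.haveCommon_of_pentCount_eq_two hv' hX hvn hv'n.symm
  -- The pentagon `z, v', v, n, q` leaves three choices of `q`. If `q = k`, the partners `z` and `v`
  -- of the ends of `kn` have the common neighbour `v'`; the other two choices give a quadrangle and
  -- a triangle.
  rcases ((hG.isNbrs hzk hz hz' hkm hkv' hmv').adj_iff q).1 hq.symm with rfl | rfl | rfl
  · refine h.not_haveCommon hG hgirth hq' hzk.symm hvn.symm ?_ ?_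
      (fun e => hG.not_adj_of_path hv' hz'.symm (e ▸ hvn)) hkv.symm ⟨v', hz'.symm, hv'.symm⟩
    · rwa [Sym2.eq_swap]
    · rwa [Sym2.eq_swap]
  · exact hn.ne₁₂ (hG.eq_of_square hum.symm hq' huv.symm hvn hnu.symm)
  · exact hG.not_adj_of_path hv' hq' hvn

end TwoThreeThree

/-! ### Recognising generalised Petersen graphs -/

/-- An injective homomorphism from a cubic graph onto a connected cubic graph is an isomorphism. -/
lemma IsCubicNoShort.nonempty_iso (hG : G.IsCubicNoShort) (hconn : G.Connected) {W : Type*}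
    [Nonempty W] {H : SimpleGraph W} (f : W → V) (hf : f.Injective)
    (hadj : ∀ {x y}, H.Adj x y → G.Adj (f x) (f y)) (hH : ∀ x, ∃ a b c, H.IsNbrs x a b c) :
    Nonempty (G ≃g H) := by
  have hn : ∀ x y, G.Adj (f x) y → ∃ z, H.Adj x z ∧ f z = y := by
    intro x y h
    obtain ⟨a, b, c, hx⟩ := hH x
    have := hG.isNbrs (hadj hx.adj₁) (hadj hx.adj₂) (hadj hx.adj₃) (hf.ne hx.ne₁₂)
      (hf.ne hx.ne₁₃) (hf.ne hx.ne₂₃)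
    rcases (this.adj_iff y).1 h with rfl | rfl | rfl
    · exact ⟨a, hx.adj₁, rfl⟩
    · exact ⟨b, hx.adj₂, rfl⟩
    · exact ⟨c, hx.adj₃, rfl⟩
  -- The image is closed under taking neighbours, since the three neighbours in `H` already fill all
  -- three places in `G`.
  have hsurj : f.Surjective := by
    intro y
    obtain ⟨x⟩ := ‹Nonempty W›
    obtain ⟨p⟩ := hconn.preconnected (f x) y
    generalize hx : f x = x' at p
    induction p generalizing x with
    | nil => exact ⟨x, hx⟩
    | cons h q ih =>
      subst hx
      obtain ⟨z, -, hz⟩ := hn _ _ h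
      exact ih z hz
  refine ⟨Iso.symm ⟨Equiv.ofBijective f ⟨hf, hsurj⟩, ?_⟩⟩
  intro x y
  refine ⟨fun h => ?_, hadj⟩
  obtain ⟨z, hz, he⟩ := hn _ _ h
  rwa [← hf he]

/-- The three inequalities keep `i + 1` apart from `i - 1`, prevent loops on the inner edges, and
keep `i + k` apart from `i - k`. -/
lemma generalizedPetersen_isNbrs {n k : ℕ} (h2 : (2 : ZMod n) ≠ 0)
    (hk : (k : ZMod n) ≠ 0) (hk2 : (2 * k : ZMod n) ≠ 0) (x : ZMod n ⊕ ZMod n) :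
    ∃ a b c, (generalizedPetersen n k).IsNbrs x a b c := by
  rcases x with i | i
  · refine ⟨.inl (i + 1), .inl (i - 1), .inr i, ?_, by simp, by simp, ?_⟩
    · rw [Ne, Sum.inl.injEq]
      intro h
      exact h2 (by linear_combination h)
    · rintro (j | j)
      · simp only [generalizedPetersen, fromRel_adj, ne_eq, Sum.inl.injEq, reduceCtorEq, or_false]
        grind
      · simp only [generalizedPetersen, fromRel_adj, ne_eq, Sum.inr.injEq, reduceCtorEq, or_false,
          false_or, not_false_eq_true, true_and]
  · refine ⟨.inr (i + k), .inr (i - k), .inl i, ?_, by simp, by simp, ?_⟩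
    · rw [Ne, Sum.inr.injEq]
      intro h
      exact hk2 (by linear_combination h)
    · rintro (j | j)
      · simp only [generalizedPetersen, fromRel_adj, ne_eq, Sum.inl.injEq, reduceCtorEq,
          false_or, not_false_eq_true, true_and]
        exact eq_comm
      · simp only [generalizedPetersen, fromRel_adj, ne_eq, Sum.inr.injEq, reduceCtorEq, or_false]
        grind

lemma IsCubicNoShort.nonempty_iso_generalizedPetersen (hG : G.IsCubicNoShort)
    (hconn : G.Connected) {n k : ℕ} (h2 : (2 : ZMod n) ≠ 0)
    (hk : (k : ZMod n) ≠ 0) (hk2 : (2 * k : ZMod n) ≠ 0) (o r : ZMod n → V)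
    (ho : ∀ i, G.Adj (o i) (o (i + 1))) (hs : ∀ i, G.Adj (o i) (r i))
    (hr : ∀ i, G.Adj (r i) (r (i + k))) (hoi : o.Injective) (hri : r.Injective)
    (hor : ∀ i j, o i ≠ r j) : Nonempty (G ≃g generalizedPetersen n k) := by
  refine hG.nonempty_iso hconn (Sum.elim o r) (hoi.sumElim hri hor) ?_
    (generalizedPetersen_isNbrs h2 hk hk2)
  rintro (i | i) (j | j) h
  · simp only [generalizedPetersen, fromRel_adj] at h
    rcases h.2 with rfl | rfl
    · exact ho _
    · exact (ho _).symm
  · simp only [generalizedPetersen, fromRel_adj] at h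
    rcases h.2 with rfl | h
    · exact hs _
    · exact h.elim
  · simp only [generalizedPetersen, fromRel_adj] at h
    rcases h.2 with h | rfl
    · exact h.elim
    · exact (hs _).symm
  · simp only [generalizedPetersen, fromRel_adj] at h
    rcases h.2 with rfl | rfl
    · exact hr _
    · exact (hr _).symm

/-! ### Largest entry 4: the Petersen graph -/

/-- The configuration around an edge `uv` in four pentagons, closed up to the Petersen graph. -/
lemma IsCubicNoShort.nodup_petersen (hG : G.IsCubicNoShort)
    {u v a b x y p q s t : V} (hu : G.IsNbrs u v a b) (hv : G.IsNbrs v u x y)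
    (hap : G.Adj a p) (haq : G.Adj a q) (hbs : G.Adj b s) (hbt : G.Adj b t)
    (hxp : G.Adj x p) (hyq : G.Adj y q) (hxs : G.Adj x s) (hyt : G.Adj y t) :
    [u, v, x, p, a, b, y, s, t, q].Nodup := by
  have hT : ∀ a b c, G.Adj a b → G.Adj a c → ¬ G.Adj b c :=
    fun a b c h1 h2 h3 => hG.not_adj_of_path h1 h3 h2
  have hS : ∀ x y a b, G.Adj x a → G.Adj x b → G.Adj y a → G.Adj y b → a = b ∨ x = y :=
    fun x y a b h1 h2 h3 h4 => or_iff_not_imp_left.2 (hG.eq_of_square h1 h2 h3 h4)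
  have hsym : ∀ a b, G.Adj a b → G.Adj b a := fun a b h => h.symm
  have hI : ∀ a, ¬ G.Adj a a := fun a => G.loopless.irrefl a
  obtain ⟨h1, h2, h3⟩ := And.intro hu.ne₁₂ (And.intro hu.ne₁₃ hu.ne₂₃)
  obtain ⟨k1, k2, k3⟩ := And.intro hv.ne₁₂ (And.intro hv.ne₁₃ hv.ne₂₃)
  obtain ⟨g1, g2, g3⟩ := And.intro hu.adj₁ (And.intro hu.adj₂ hu.adj₃)
  obtain ⟨l1, l2⟩ := And.intro hv.adj₂ hv.adj₃
  clear hu hv hG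
  simp only [List.nodup_cons, List.mem_cons, List.not_mem_nil, or_false, not_or, List.nodup_nil]
  refine ⟨⟨?_, ?_, ?_, ?_, ?_, ?_, ?_, ?_, ?_⟩, ⟨?_, ?_, ?_, ?_, ?_, ?_, ?_, ?_⟩,
    ⟨?_, ?_, ?_, ?_, ?_, ?_, ?_⟩, ⟨?_, ?_, ?_, ?_, ?_, ?_⟩, ⟨?_, ?_, ?_, ?_, ?_⟩,
    ⟨?_, ?_, ?_, ?_⟩, ⟨?_, ?_, ?_⟩, ⟨?_, ?_⟩, ?_, ?_⟩
  -- Identifying two of the vertices not already known to be distinct would create a loop, a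
  -- triangle or a quadrangle.
  all_goals first | trivial | (try intro e; subst e; grind)

lemma IsCubicNoShort.nonempty_iso_petersen (hG : G.IsCubicNoShort) (hconn : G.Connected)
    {u v a b x y p q s t : V} (hu : G.IsNbrs u v a b) (hv : G.IsNbrs v u x y)
    (hap : G.Adj a p) (haq : G.Adj a q) (hbs : G.Adj b s) (hbt : G.Adj b t)
    (hxp : G.Adj x p) (hyq : G.Adj y q) (hxs : G.Adj x s) (hyt : G.Adj y t)
    (hpt : G.Adj p t) (hqs : G.Adj q s) : Nonempty (G ≃g petersenGraph) := by
  have hd := hG.nodup_petersen hu hv hap haq hbs hbt hxp hyq hxs hyt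
  have hinj := List.nodup_iff_injective_get.1 hd
  -- The outer cycle is `u, v, x, p, a`, and the spokes lead to `b, y, s, t, q` in this order.
  let o : ZMod 5 → V := fun i => [u, v, x, p, a, b, y, s, t, q].get (Fin.castLE (by simp : 5 ≤ 10) i)
  let r : ZMod 5 → V := fun i => [u, v, x, p, a, b, y, s, t, q].get (Fin.natAdd 5 i)
  refine hG.nonempty_iso_generalizedPetersen hconn (by decide) (by decide) (by decide) o r
    ?_ ?_ ?_ ?_ ?_ ?_
  · intro i
    fin_cases i
    exacts [hu.adj₁, hv.adj₂, hxp, hap.symm, hu.adj₂.symm]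
  · intro i
    fin_cases i
    exacts [hu.adj₃, hv.adj₃, hxs, hpt, haq]
  · intro i
    fin_cases i
    exacts [hbs, hyt, hqs.symm, hbt.symm, hyq.symm]
  · exact hinj.comp (Fin.castLE_injective _)
  · exact hinj.comp (Fin.natAdd_injective _ _)
  · intro i j h
    have : Fin.val (n := 5) i = 5 + Fin.val (n := 5) j := congrArg Fin.val (hinj h)
    have hi : Fin.val (n := 5) i < 5 := Fin.is_lt (n := 5) i
    omega

/-- An edge in four pentagons has another one next to it, and these two force the Petersen graph. -/
lemma IsCubicNoShort.nonempty_iso_petersen_of_type (hG : G.IsCubicNoShort)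
    (hgirth : G.girth = 5) (hconn : G.Connected) {α β : ℕ} (h : G.HasType α β 4) :
    Nonempty (G ≃g petersenGraph) := by
  have hfour : ∀ {u v a b : V}, G.IsNbrs u v a b → G.girthCycleCount s(u, v) = 4 →
      G.pentCount a u v = 2 ∧ G.pentCount b u v = 2 := by
    intro u v a b hn h4
    have h1 := girthCycleCount_eq hG hgirth hn
    have h2 := hG.pentCount_le (a := a) hn.adj₁
    have h3 := hG.pentCount_le (a := b) hn.adj₁
    omega
  obtain ⟨u⟩ := hconn.nonempty
  obtain ⟨a, b, v, hu, -, -, huv⟩ := h u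
  replace hu := hu.rotate.rotate
  obtain ⟨hav, hbv⟩ := hfour hu huv
  obtain ⟨x, y, hv⟩ := hG.nbrs_of_adj hu.adj₁.symm
  have main : ∀ {x y p q : V}, G.IsNbrs v u x y → G.IsNbrs a u p q → G.Adj p x → G.Adj q y →
      (G.girthCycleCount s(a, u) = 4 ∨ G.girthCycleCount s(a, p) = 4) →
      Nonempty (G ≃g petersenGraph) := by
    intro x y p q hv ha hxp hyq h4
    obtain ⟨s, hs, hs'⟩ := hG.haveCommon_of_pentCount_eq_two hu.adj₁.symm hbv hv.adj₂ hv.ne₁₂.symm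
    obtain ⟨t, ht, ht'⟩ := hG.haveCommon_of_pentCount_eq_two hu.adj₁.symm hbv hv.adj₃ hv.ne₁₃.symm
    have hd := hG.nodup_petersen hu hv ha.adj₂ ha.adj₃ hs.symm ht.symm hxp.symm hyq.symm
      hs'.symm ht'.symm
    simp only [List.nodup_cons, List.mem_cons, List.not_mem_nil, or_false, not_or] at hd
    have hb : G.IsNbrs b u s t := hG.isNbrs hu.adj₃.symm hs.symm ht.symm (by grind) (by grind)
      (by grind)
    have hx : G.IsNbrs x v p s := hG.isNbrs hv.adj₂.symm hxp.symm hs'.symm (by grind) (by grind)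
      (by grind)
    have hps : ¬ G.Adj p s := fun hps => hG.not_adj_of_path hxp hs'.symm hps
    have hqt : ¬ G.Adj q t := fun hqt => hG.not_adj_of_path hyq ht'.symm hqt
    have hpq : ¬ G.Adj p q := fun hpq => hG.not_adj_of_path ha.adj₂ hpq ha.adj₃
    suffices G.Adj p t ∧ G.Adj q s from hG.nonempty_iso_petersen hconn hu hv ha.adj₂ ha.adj₃
      hs.symm ht.symm hxp.symm hyq.symm hs'.symm ht'.symm this.1 this.2
    rcases h4 with h4 | h4
    -- The path `b, u, a` lies in two pentagons, so `b` has a common neighbour with `p` and with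
    -- `q`. Short cycles leave only `t` for `p` and `s` for `q`.
    · have hX := (hfour hu.rotate (by rwa [Sym2.eq_swap])).1
      have hub : ∀ w, G.Adj a w → w ≠ u → G.HaveCommon b w := fun w hw hwu =>
        hG.haveCommon_of_pentCount_eq_two hu.adj₂.symm hX hw hwu
      obtain ⟨z, hz, hz'⟩ := hub p ha.adj₂ ha.ne₁₂.symm
      obtain ⟨z', hz2, hz2'⟩ := hub q ha.adj₃ ha.ne₁₃.symm
      have h1 := (hb.adj_iff z).1 hz.symm
      have h2 := (hb.adj_iff z').1 hz2.symm
      have hup : ¬ G.Adj u p := fun e => hG.not_adj_of_path hu.adj₂ ha.adj₂ e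
      have huq : ¬ G.Adj u q := fun e => hG.not_adj_of_path hu.adj₂ ha.adj₃ e
      constructor
      · rcases h1 with rfl | rfl | rfl
        · exact absurd hz' hup
        · exact absurd hz'.symm hps
        · exact hz'.symm
      · rcases h2 with rfl | rfl | rfl
        · exact absurd hz2' huq
        · exact hz2'.symm
        · exact absurd hz2'.symm hqt
    -- Both `q, a, p` and `u, a, p` lie in two pentagons. The first makes `q` adjacent to `s`; the
    -- second forces the third neighbour `w` of `p` to be `t`.
    · obtain ⟨hX1, hX2⟩ := hfour ha.rotate h4
      obtain ⟨w, hp⟩ := hG.nbrs_of_adj₂ ha.adj₂.symm hxp (by grind)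
      obtain ⟨z, hz, hz'⟩ := hG.haveCommon_of_pentCount_eq_two ha.adj₂.symm hX1 hxp (by grind)
      obtain ⟨z', hz2, hz2'⟩ := hG.haveCommon_of_pentCount_eq_two ha.adj₂.symm hX2 hp.adj₃
        hp.ne₁₃.symm
      have hup : ¬ G.Adj u p := fun e => hG.not_adj_of_path hu.adj₂ ha.adj₂ e
      have hvq : ¬ G.Adj v q := fun e => hG.not_adj_of_path hv.adj₃ hyq.symm e
      constructor
      · rcases (hu.adj_iff z').1 hz2.symm with rfl | rfl | rfl
        · rcases (hv.adj_iff w).1 hz2' with rfl | rfl | rfl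
          · exact absurd hp.adj₃.symm hup
          · exact absurd rfl hp.ne₂₃
          · have := hG.eq_of_square hv.adj₂ hv.adj₃ hxp hp.adj₃ hv.ne₂₃
            grind
        · exact absurd hp.adj₃ (fun e => hG.not_adj_of_path ha.adj₂ e hz2')
        · rcases (hb.adj_iff w).1 hz2' with rfl | rfl | rfl
          · exact absurd hp.adj₃.symm hup
          · exact absurd hp.adj₃ hps
          · exact hp.adj₃
      · rcases (hx.adj_iff z).1 hz'.symm with rfl | rfl | rfl
        · exact absurd hz hvq
        · exact absurd hz hpq
        · exact hz.symm
  obtain ⟨p, hp, hp'⟩ := hG.haveCommon_of_pentCount_eq_two hu.adj₁.symm hav hv.adj₂ hv.ne₁₂.symm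
  obtain ⟨q, hq, hq'⟩ := hG.haveCommon_of_pentCount_eq_two hu.adj₁.symm hav hv.adj₃ hv.ne₁₃.symm
  have hpu : p ≠ u := by
    rintro rfl
    exact hG.not_adj_of_path hu.adj₁ hv.adj₂ hp'
  have hqu : q ≠ u := by
    rintro rfl
    exact hG.not_adj_of_path hu.adj₁ hv.adj₃ hq'
  have hpq : p ≠ q := by
    rintro rfl
    have := hG.eq_of_square hv.adj₂ hv.adj₃ hp' hq' hv.ne₂₃
    exact hG.not_adj_of_path hu.adj₁ (this ▸ hp) hu.adj₂
  have ha := hG.isNbrs hu.adj₂.symm hp.symm hq.symm hpu.symm hqu.symm hpq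
  -- The edge in four pentagons at `a` is `au`, `ap` or `aq`; exchanging `x` with `y` and `p` with
  -- `q` reduces the last to the second.
  obtain ⟨_, _, c, hn, -, -, hc⟩ := h a
  rcases (ha.adj_iff c).1 hn.adj₃ with rfl | rfl | rfl
  · exact main hv ha hp' hq' (.inl hc)
  · exact main hv ha hp' hq' (.inr hc)
  · exact main hv.swap ha.swap hq' hp' (.inr hc)

/-! ### Type (2,2,2): the dodecahedron -/

/-- Every path with two edges lies in exactly one pentagon. -/
def UniquePentagon (G : SimpleGraph V) : Prop :=
  ∀ {a u v}, G.Adj u a → G.Adj u v → a ≠ v → G.pentCount a u v = 1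

lemma HasType.uniquePentagon (hG : G.IsCubicNoShort) (hgirth : G.girth = 5)
    (h : G.HasType 2 2 2) : G.UniquePentagon := by
  intro a u v ha hv hav
  obtain ⟨c, hn⟩ := hG.nbrs_of_adj₂ ha hv hav
  have e := hG.girthCycleCount_eqs hgirth hn
  have hall : ∀ x, G.Adj u x → G.girthCycleCount s(u, x) = 2 := by
    intro x hx
    obtain ⟨_, _, _, hn', e1, e2, e3⟩ := h u
    rcases (hn'.adj_iff x).1 hx with rfl | rfl | rfl <;> assumption
  have e1 := hall _ hn.adj₁
  have e2 := hall _ hn.adj₂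
  have e3 := hall _ hn.adj₃
  omega

lemma UniquePentagon.eq (hX : G.UniquePentagon) {a u v b b' : V} (hau : G.Adj a u)
    (huv : G.Adj u v) (hav : a ≠ v) (hb : G.Adj v b) (hbu : b ≠ u) (h : G.HaveCommon a b)
    (hb' : G.Adj v b') (hbu' : b' ≠ u) (h' : G.HaveCommon a b') : b = b' :=
  eq_of_pentCount_eq_one (hX hau.symm huv hav) hb hbu h hb' hbu' h'

/-- Two infinite paths `o` and `i ↦ r (2 * i)`, `i ↦ r (2 * i + 1)`, joined by spokes `o i`, `r i`,
as in a generalised Petersen graph `GP(n, 2)`. -/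
structure IsLadder (G : SimpleGraph V) (o r : ℕ → V) : Prop where
  isNbrs : ∀ i, G.IsNbrs (o (i + 1)) (o i) (o (i + 2)) (r (i + 1))
  spoke : ∀ i, G.Adj (o i) (r i)
  rail : ∀ i, G.Adj (r i) (r (i + 2))

/-- A pentagon `r₀, o₀, o₁, o₂, r₂` together with the third neighbour of `o₁`. -/
structure IsLadderStep (G : SimpleGraph V) (o₀ o₁ o₂ r₀ r₁ r₂ : V) : Prop where
  isNbrs : G.IsNbrs o₁ o₀ o₂ r₁
  spoke₀ : G.Adj o₀ r₀
  spoke₂ : G.Adj o₂ r₂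
  rail : G.Adj r₀ r₂

/-- The pentagon on `r₁, o₁, o₂` cannot continue to `r₂`, because the only pentagon on `r₂, o₂, o₁`
runs through `o₀`. So it continues to the third neighbour of `o₂`, and its fifth vertex is `r₃`. -/
lemma IsLadderStep.exists_next (hG : G.IsCubicNoShort) (hX : G.UniquePentagon)
    {o₀ o₁ o₂ r₀ r₁ r₂ : V} (h : G.IsLadderStep o₀ o₁ o₂ r₀ r₁ r₂) :
    ∃ o₃ r₃, G.IsLadderStep o₁ o₂ o₃ r₁ r₂ r₃ := by
  have hn := h.isNbrs
  have hr₂ : r₂ ≠ o₁ := by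
    rintro rfl
    exact hG.not_adj_of_path h.spoke₀ h.rail hn.adj₁.symm
  obtain ⟨o₃, ho⟩ := hG.nbrs_of_adj₂ hn.adj₂.symm h.spoke₂ hr₂.symm
  obtain ⟨b, hb, hb1, hc⟩ := exists_of_pentCount_pos
    (by rw [hX hn.adj₃ hn.adj₂ hn.ne₂₃.symm]; simp : 0 < G.pentCount r₁ o₁ o₂)
  rcases (ho.adj_iff b).1 hb with rfl | rfl | rfl
  · exact absurd rfl hb1
  · exact absurd (hX.eq h.spoke₂.symm hn.adj₂.symm hr₂ hn.adj₁ hn.ne₁₂ ⟨r₀, h.rail, h.spoke₀.symm⟩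
      hn.adj₃ hn.ne₂₃.symm hc.symm) hn.ne₁₃
  · obtain ⟨r₃, h1, h2⟩ := hc
    exact ⟨b, r₃, ho.swap, hn.adj₃, h2.symm, h1.symm⟩

lemma IsCubicNoShort.exists_isLadder (hG : G.IsCubicNoShort) (hX : G.UniquePentagon)
    [Nonempty V] : ∃ o r, G.IsLadder o r := by
  let S := {s : Fin 3 → V × V //
    G.IsLadderStep (s 0).1 (s 1).1 (s 2).1 (s 0).2 (s 1).2 (s 2).2}
  have hnext : ∀ s : S, ∃ t : S, t.1 0 = s.1 1 ∧ t.1 1 = s.1 2 := by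
    rintro ⟨s, hs⟩
    obtain ⟨o₃, r₃, h⟩ := hs.exists_next hG hX
    exact ⟨⟨![s 1, s 2, (o₃, r₃)], h⟩, rfl, rfl⟩
  choose f hf using hnext
  obtain ⟨u⟩ := ‹Nonempty V›
  obtain ⟨a, b, c, hn⟩ := hG.exists_isNbrs u
  obtain ⟨p, hp, hpu, w, hw, hw'⟩ := exists_of_pentCount_pos
    (by rw [hX hn.adj₁ hn.adj₂ hn.ne₁₂]; simp : 0 < G.pentCount a u b)
  -- The rungs of the pentagon `w, a, u, b, p`, with `c` as the third neighbour of `u`.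
  let s₀ : S := ⟨![(a, w), (u, c), (b, p)], hn, hw.symm, hp, hw'⟩
  have h1 : ∀ n, (f^[n] s₀).1 1 = (f^[n + 1] s₀).1 0 := fun n => by
    rw [Function.iterate_succ_apply', (hf _).1]
  have h2 : ∀ n, (f^[n] s₀).1 2 = (f^[n + 2] s₀).1 0 := fun n => by
    rw [← h1 (n + 1), Function.iterate_succ_apply', (hf _).2]
  have key := fun n => (f^[n] s₀).2
  simp only [h1, h2] at key
  exact ⟨fun n => ((f^[n] s₀).1 0).1, fun n => ((f^[n] s₀).1 0).2,
    fun n => (key n).isNbrs, fun n => (key n).spoke₀, fun n => (key n).rail⟩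

namespace IsLadder

variable {o r : ℕ → V}

lemma side (h : G.IsLadder o r) (i : ℕ) : G.Adj (o i) (o (i + 1)) := (h.isNbrs i).adj₁.symm

lemma shift (h : G.IsLadder o r) (k : ℕ) : G.IsLadder (fun i => o (i + k)) fun i => r (i + k) where
  isNbrs i := by simpa only [Nat.add_right_comm _ _ k] using h.isNbrs (i + k)
  spoke i := h.spoke (i + k)
  rail i := by simpa only [Nat.add_right_comm _ _ k] using h.rail (i + k)

lemma o_ne_o_two (h : G.IsLadder o r) (i : ℕ) : o i ≠ o (i + 2) := (h.isNbrs i).ne₁₂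

lemma o_ne_r_one (h : G.IsLadder o r) (i : ℕ) : o i ≠ r (i + 1) := (h.isNbrs i).ne₁₃

lemma r_one_ne_o_two (h : G.IsLadder o r) (i : ℕ) : r (i + 1) ≠ o (i + 2) :=
  (h.isNbrs i).ne₂₃.symm

lemma o_ne_r_two (hG : G.IsCubicNoShort) (h : G.IsLadder o r) (i : ℕ) : o i ≠ r (i + 2) :=
  fun e => hG.not_adj_of_path (h.side i) (h.side (i + 1)) (e ▸ (h.spoke (i + 2)).symm)

lemma r_ne_o_one (hG : G.IsCubicNoShort) (h : G.IsLadder o r) (i : ℕ) : r i ≠ o (i + 1) :=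
  fun e => hG.not_adj_of_path (h.rail i).symm (e ▸ h.side (i + 1)) (h.spoke (i + 2)).symm

lemma r_ne_o_two (hG : G.IsCubicNoShort) (h : G.IsLadder o r) (i : ℕ) : r i ≠ o (i + 2) :=
  fun e => hG.not_adj_of_path (h.side i) (h.side (i + 1)) (e ▸ h.spoke i)

lemma r_ne_o_three (hG : G.IsCubicNoShort) (h : G.IsLadder o r) (i : ℕ) : r i ≠ o (i + 3) :=
  fun e => hG.not_adj_of_path (h.rail i).symm (e ▸ (h.side (i + 2)).symm) (h.spoke (i + 2)).symm

lemma r_ne_o_four (hG : G.IsCubicNoShort) (h : G.IsLadder o r) (i : ℕ) : r i ≠ o (i + 4) :=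
  fun e => hG.not_adj_of_path (h.rail i) (h.rail (i + 2)) (e ▸ h.spoke (i + 4))

lemma o_ne_r_three (hG : G.IsCubicNoShort) (h : G.IsLadder o r) (i : ℕ) : o i ≠ r (i + 3) :=
  fun e => hG.not_adj_of_path (h.side i) (h.spoke (i + 1)) (e ▸ (h.rail (i + 1)).symm)

lemma o_ne_r_four (hG : G.IsCubicNoShort) (h : G.IsLadder o r) (i : ℕ) : o i ≠ r (i + 4) :=
  fun e => hG.not_adj_of_path (h.rail i) (h.rail (i + 2)) (e ▸ (h.spoke i).symm)

lemma o_ne_r_five (hG : G.IsCubicNoShort) (h : G.IsLadder o r) (i : ℕ) : o i ≠ r (i + 5) :=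
  fun e => h.o_ne_r_one i (hG.eq_of_square (h.side i) (e ▸ (h.rail (i + 3)).symm)
    (h.spoke (i + 1)).symm (h.rail (i + 1)) (h.o_ne_r_two hG (i + 1)))

lemma o_ne_o_three (hG : G.IsCubicNoShort) (h : G.IsLadder o r) (i : ℕ) : o i ≠ o (i + 3) :=
  fun e => hG.not_adj_of_path (h.side i) (h.side (i + 1)) (e ▸ (h.side (i + 2)).symm)

lemma o_ne_o_four (hG : G.IsCubicNoShort) (h : G.IsLadder o r) (i : ℕ) : o i ≠ o (i + 4) :=
  fun e => h.o_ne_o_two i (hG.eq_of_square (h.side i) (e ▸ (h.side (i + 3)).symm)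
    (h.side (i + 1)).symm (h.side (i + 2)) (h.o_ne_o_two (i + 1)))

lemma o_ne_o_five (hX : G.UniquePentagon) (h : G.IsLadder o r) (i : ℕ) : o i ≠ o (i + 5) :=
  fun e => h.r_one_ne_o_two (i + 1) (hX.eq (h.side i) (h.side (i + 1)) (h.o_ne_o_two i)
    (h.spoke (i + 2)) (h.o_ne_r_one (i + 1)).symm ⟨r i, (h.spoke i).symm, h.rail i⟩
    (h.side (i + 2)) (h.o_ne_o_two (i + 1)).symm
    ⟨o (i + 4), e ▸ h.side (i + 4), (h.side (i + 3)).symm⟩)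

lemma r_ne_r_one (hG : G.IsCubicNoShort) (h : G.IsLadder o r) (i : ℕ) : r i ≠ r (i + 1) :=
  fun e => hG.not_adj_of_path (h.side i) (h.spoke (i + 1)) (e ▸ h.spoke i)

lemma r_ne_r_three (hG : G.IsCubicNoShort) (h : G.IsLadder o r) (i : ℕ) : r i ≠ r (i + 3) :=
  fun e => h.r_ne_o_one hG i (hG.eq_of_square (h.spoke i).symm (e ▸ (h.rail (i + 1)).symm)
    (h.side i).symm (h.spoke (i + 1)) (h.o_ne_r_one i))

lemma r_ne_r_four (hG : G.IsCubicNoShort) (hX : G.UniquePentagon) (h : G.IsLadder o r) (i : ℕ) :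
    r i ≠ r (i + 4) :=
  fun e => h.o_ne_o_two (i + 1) (hX.eq (h.rail i) (h.spoke (i + 2)).symm (h.r_ne_o_two hG i)
    (h.side (i + 1)).symm (h.o_ne_r_one (i + 1)) ⟨o i, h.spoke i, h.side i⟩
    (h.side (i + 2)) (h.r_ne_o_one hG (i + 2)).symm
    ⟨o (i + 4), e ▸ h.spoke (i + 4), (h.side (i + 3)).symm⟩)

lemma r_ne_r_five (hG : G.IsCubicNoShort) (hX : G.UniquePentagon) (h : G.IsLadder o r) (i : ℕ) :
    r i ≠ r (i + 5) :=
  fun e => h.r_one_ne_o_two i (hX.eq (h.spoke i).symm (h.side i) (h.r_ne_o_one hG i)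
    (h.spoke (i + 1)) (h.o_ne_r_one i).symm ⟨r (i + 3), e ▸ (h.rail (i + 3)), (h.rail (i + 1)).symm⟩
    (h.side (i + 1)) (h.o_ne_o_two i).symm ⟨r (i + 2), (h.rail i).symm, (h.spoke (i + 2)).symm⟩)

lemma r_ne_o_five (hG : G.IsCubicNoShort) (hX : G.UniquePentagon) (h : G.IsLadder o r) (i : ℕ) :
    r i ≠ o (i + 5) :=
  fun e => h.r_ne_o_two hG (i + 2) (hG.eq_of_square (h.rail (i + 2)) (e ▸ (h.rail i).symm)
    (h.spoke (i + 4)) (h.side (i + 4)) (e ▸ (h.r_ne_r_four hG hX i).symm))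

lemma isNbrs_r (hG : G.IsCubicNoShort) (hX : G.UniquePentagon) (h : G.IsLadder o r) (i : ℕ) :
    G.IsNbrs (r (i + 2)) (r i) (r (i + 4)) (o (i + 2)) :=
  hG.isNbrs (h.rail i).symm (h.rail (i + 2)) (h.spoke (i + 2)).symm (h.r_ne_r_four hG hX i)
    (h.r_ne_o_two hG i) (h.o_ne_r_two hG (i + 2)).symm

/-- The pentagon on `r i, r (i + 2), r (i + 4)` cannot turn to `o (i + 4)`: the path `o (i + 4), r
(i + 4), r (i + 2)` already has its pentagon through `o (i + 2)`. So it follows the rail. -/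
lemma haveCommon_r_six (hG : G.IsCubicNoShort) (hX : G.UniquePentagon) (h : G.IsLadder o r)
    (i : ℕ) : G.HaveCommon (r i) (r (i + 6)) := by
  obtain ⟨b, hb, hb1, hc⟩ := exists_of_pentCount_pos (by
    rw [hX (h.rail i).symm (h.rail (i + 2)) (h.r_ne_r_four hG hX i)]; simp :
    0 < G.pentCount (r i) (r (i + 2)) (r (i + 4)))
  rcases ((h.isNbrs_r hG hX (i + 2)).adj_iff b).1 hb with rfl | rfl | rfl
  · exact absurd rfl hb1
  · exact hc
  · exact absurd (hX.eq (h.spoke (i + 4)) (h.rail (i + 2)).symm (h.r_ne_o_two hG (i + 2)).symm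
      (h.rail i).symm (h.r_ne_r_four hG hX i) hc.symm (h.spoke (i + 2)).symm
      (h.o_ne_r_two hG (i + 2)) ⟨o (i + 3), h.side (i + 3), (h.side (i + 2)).symm⟩)
      (h.r_ne_o_two hG i)

lemma r_ne_r_six (hG : G.IsCubicNoShort) (h : G.IsLadder o r) (i : ℕ) : r i ≠ r (i + 6) :=
  fun e => hG.not_adj_of_path (h.rail i) (h.rail (i + 2)) (e ▸ (h.rail (i + 4)).symm)

/-- The vertex closing the pentagon on `r i, …, r (i + 6)` is not `o (i + 6)`, because the pentagon
on `r (i + 4), r (i + 6), o (i + 6)` runs through `o (i + 5)`. So the rail of each parity closes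
into a 5-cycle. -/
lemma r_eight_adj (hG : G.IsCubicNoShort) (hX : G.UniquePentagon) (h : G.IsLadder o r)
    (i : ℕ) : G.Adj (r (i + 8)) (r i) := by
  obtain ⟨w, hw, hw'⟩ := h.haveCommon_r_six hG hX i
  rcases ((h.isNbrs_r hG hX (i + 4)).adj_iff w).1 hw'.symm with rfl | rfl | rfl
  · exact absurd hw.symm (hG.not_adj_of_path (h.rail i) (h.rail (i + 2)))
  · exact hw
  · exact absurd (hX.eq (h.rail (i + 4)) (h.spoke (i + 6)).symm (h.r_ne_o_two hG (i + 4))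
      hw (h.r_ne_r_six hG i) ⟨r (i + 2), h.rail (i + 2), (h.rail i).symm⟩ (h.side (i + 5)).symm
      (h.o_ne_r_one (i + 5)) ⟨o (i + 4), h.spoke (i + 4), h.side (i + 4)⟩)
      (h.r_ne_o_five hG hX i)

lemma r_ten (hG : G.IsCubicNoShort) (hX : G.UniquePentagon) (h : G.IsLadder o r)
    (i : ℕ) : r (i + 10) = r i := by
  rcases ((h.isNbrs_r hG hX (i + 6)).adj_iff (r i)).1 (h.r_eight_adj hG hX i) with e | e | e
  · exact absurd e (h.r_ne_r_six hG i)
  · exact e.symm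
  · exact absurd (hX.eq (h.rail (i + 6)) (h.spoke (i + 8)).symm (h.r_ne_o_two hG (i + 6))
      (e ▸ h.rail i) (h.r_ne_r_six hG (i + 2)) ⟨r (i + 4), h.rail (i + 4), (h.rail (i + 2)).symm⟩
      (h.side (i + 7)).symm
      (h.o_ne_r_one (i + 7)) ⟨o (i + 6), h.spoke (i + 6), h.side (i + 6)⟩)
      (h.r_ne_o_five hG hX (i + 2))

/-- `o (i + 2)` is the neighbour of `r (i + 2)` off the rail, so the period of `r` carries over. -/
lemma o_ten (hG : G.IsCubicNoShort) (hX : G.UniquePentagon) (h : G.IsLadder o r)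
    (i : ℕ) : o (i + 12) = o (i + 2) := by
  have h1 := (h.spoke (i + 12)).symm
  rw [show i + 12 = i + 2 + 10 by ring, h.r_ten hG hX] at h1
  rcases ((h.isNbrs_r hG hX i).adj_iff _).1 h1 with e | e | e
  · exact absurd e.symm (by rw [← h.r_ten hG hX i]; exact h.r_ne_o_two hG (i + 10))
  · exact absurd e (by rw [← h.r_ten hG hX (i + 4)]; exact h.o_ne_r_two hG (i + 12))
  · exact e

/-- Index differences up to 5 are excluded by short cycles or by uniqueness of pentagons; larger
ones become differences below 5 by going the other way around the period. The next three lemmas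
follow the same pattern. -/
lemma o_ne_o (hG : G.IsCubicNoShort) (hX : G.UniquePentagon) (h : G.IsLadder o r)
    (hop : ∀ i, o (i + 10) = o i) {a b : ℕ} (hab : a < b) (hba : b < a + 10) : o a ≠ o b := by
  obtain ⟨d, rfl⟩ := Nat.exists_eq_add_of_lt hab
  have hd : d < 9 := by omega
  interval_cases d
  · exact (h.side a).ne
  · exact h.o_ne_o_two a
  · exact h.o_ne_o_three hG a
  · exact h.o_ne_o_four hG a
  · exact h.o_ne_o_five hX a
  · exact hop a ▸ (h.o_ne_o_four hG (a + 6)).symm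
  · exact hop a ▸ (h.o_ne_o_three hG (a + 7)).symm
  · exact hop a ▸ (h.o_ne_o_two (a + 8)).symm
  · exact hop a ▸ (h.side (a + 9)).ne.symm

lemma r_ne_r (hG : G.IsCubicNoShort) (hX : G.UniquePentagon) (h : G.IsLadder o r)
    (hrp : ∀ i, r (i + 10) = r i) {a b : ℕ} (hab : a < b) (hba : b < a + 10) : r a ≠ r b := by
  obtain ⟨d, rfl⟩ := Nat.exists_eq_add_of_lt hab
  have hd : d < 9 := by omega
  interval_cases d
  · exact h.r_ne_r_one hG a
  · exact (h.rail a).ne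
  · exact h.r_ne_r_three hG a
  · exact h.r_ne_r_four hG hX a
  · exact h.r_ne_r_five hG hX a
  · exact hrp a ▸ (h.r_ne_r_four hG hX (a + 6)).symm
  · exact hrp a ▸ (h.r_ne_r_three hG (a + 7)).symm
  · exact hrp a ▸ (h.rail (a + 8)).ne.symm
  · exact hrp a ▸ (h.r_ne_r_one hG (a + 9)).symm

lemma o_ne_r (hG : G.IsCubicNoShort) (h : G.IsLadder o r)
    (hop : ∀ i, o (i + 10) = o i) {a b : ℕ} (hab : a ≤ b) (hba : b < a + 10) : o a ≠ r b := by
  obtain ⟨d, rfl⟩ := Nat.exists_eq_add_of_le hab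
  have hd : d < 10 := by omega
  interval_cases d
  · exact (h.spoke a).ne
  · exact h.o_ne_r_one a
  · exact h.o_ne_r_two hG a
  · exact h.o_ne_r_three hG a
  · exact h.o_ne_r_four hG a
  · exact h.o_ne_r_five hG a
  · exact hop a ▸ (h.r_ne_o_four hG (a + 6)).symm
  · exact hop a ▸ (h.r_ne_o_three hG (a + 7)).symm
  · exact hop a ▸ (h.r_ne_o_two hG (a + 8)).symm
  · exact hop a ▸ (h.r_ne_o_one hG (a + 9)).symm

lemma r_ne_o (hG : G.IsCubicNoShort) (hX : G.UniquePentagon) (h : G.IsLadder o r)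
    (hrp : ∀ i, r (i + 10) = r i) {a b : ℕ} (hab : a ≤ b) (hba : b < a + 10) : r a ≠ o b := by
  obtain ⟨d, rfl⟩ := Nat.exists_eq_add_of_le hab
  have hd : d < 10 := by omega
  interval_cases d
  · exact (h.spoke a).ne.symm
  · exact h.r_ne_o_one hG a
  · exact h.r_ne_o_two hG a
  · exact h.r_ne_o_three hG a
  · exact h.r_ne_o_four hG a
  · exact h.r_ne_o_five hG hX a
  · exact hrp a ▸ (h.o_ne_r_four hG (a + 6)).symm
  · exact hrp a ▸ (h.o_ne_r_three hG (a + 7)).symm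
  · exact hrp a ▸ (h.o_ne_r_two hG (a + 8)).symm
  · exact hrp a ▸ (h.o_ne_r_one (a + 9)).symm

end IsLadder

lemma IsCubicNoShort.nonempty_iso_dodecahedron (hG : G.IsCubicNoShort) (hconn : G.Connected)
    (hX : G.UniquePentagon) : Nonempty (G ≃g dodecahedronGraph) := by
  have := hconn.nonempty
  obtain ⟨o, r, h, hop, hrp⟩ : ∃ o r, G.IsLadder o r ∧ (∀ i, o (i + 10) = o i) ∧
      ∀ i, r (i + 10) = r i := by
    obtain ⟨o, r, h⟩ := hG.exists_isLadder hX
    -- Periodicity of `o` is known only from index 2 on, so the ladder is started there.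
    exact ⟨_, _, h.shift 2, h.o_ten hG hX, fun i => h.r_ten hG hX (i + 2)⟩
  have hmod : ∀ {f : ℕ → V}, (∀ i, f (i + 10) = f i) → ∀ (i : ZMod 10) (k : ℕ),
      f (i + k : ZMod 10).val = f (i.val + k) := by
    intro f hf i k
    rw [ZMod.val_add, ZMod.val_natCast, Nat.add_mod_mod]
    exact Function.Periodic.map_mod_nat hf _
  have hlt : ∀ i : ZMod 10, i.val < 10 := fun i => i.val_lt
  have hval := ZMod.val_injective 10
  refine hG.nonempty_iso_generalizedPetersen hconn (by decide) (by decide) (by decide)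
    (fun i => o i.val) (fun i => r i.val) ?_ ?_ ?_ ?_ ?_ ?_
  · intro i
    have := hmod hop i 1
    rw [Nat.cast_one] at this
    simpa only [this] using h.side i.val
  · exact fun i => h.spoke i.val
  · intro i
    simpa only [hmod hrp i 2] using h.rail i.val
  · intro i j e
    by_contra hne
    rcases lt_or_gt_of_ne (hval.ne hne) with hl | hl
    · exact h.o_ne_o hG hX hop hl ((hlt j).trans_le (by simp)) e
    · exact h.o_ne_o hG hX hop hl ((hlt i).trans_le (by simp)) e.symm
  · intro i j e
    by_contra hne
    rcases lt_or_gt_of_ne (hval.ne hne) with hl | hl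
    · exact h.r_ne_r hG hX hrp hl ((hlt j).trans_le (by simp)) e
    · exact h.r_ne_r hG hX hrp hl ((hlt i).trans_le (by simp)) e.symm
  · intro i j e
    rcases le_total i.val j.val with hl | hl
    · exact h.o_ne_r hG hop hl ((hlt j).trans_le (by simp)) e
    · exact h.r_ne_o hG hX hrp hl ((hlt i).trans_le (by simp)) e.symm

/-! ### Type (0,1,1): truncations -/

/-- The subgraph of the edges that lie in exactly one girth cycle. -/
def oneGraph (G : SimpleGraph V) : SimpleGraph V where
  Adj u v := G.Adj u v ∧ G.girthCycleCount s(u, v) = 1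
  symm := ⟨fun _ _ h => ⟨h.1.symm, Sym2.eq_swap ▸ h.2⟩⟩
  loopless := ⟨fun _ h => h.1.ne rfl⟩

namespace HasType

/-- The vertex joined to `v` by the edge in no girth cycle. -/
noncomputable def mate (h : G.HasType 0 1 1) (v : V) : V := (h v).choose

lemma exists_isNbrs_mate (h : G.HasType 0 1 1) (v : V) :
    ∃ b c, G.IsNbrs v (h.mate v) b c ∧ G.girthCycleCount s(v, h.mate v) = 0 ∧
      G.oneGraph.Adj v b ∧ G.oneGraph.Adj v c :=
  let ⟨b, c, hn, h1, h2, h3⟩ := (h v).choose_spec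
  ⟨b, c, hn, h1, ⟨hn.adj₂, h2⟩, hn.adj₃, h3⟩

lemma adj_mate (h : G.HasType 0 1 1) (v : V) : G.Adj v (h.mate v) :=
  let ⟨_, _, hn, _⟩ := h.exists_isNbrs_mate v
  hn.adj₁

lemma not_oneGraph_adj_mate (h : G.HasType 0 1 1) (v : V) : ¬ G.oneGraph.Adj v (h.mate v) :=
  let ⟨_, _, _, h0, _⟩ := h.exists_isNbrs_mate v
  fun hc => by have := hc.2; omega

lemma adj_iff (h : G.HasType 0 1 1) {v w : V} :
    G.Adj v w ↔ w = h.mate v ∨ G.oneGraph.Adj v w := by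
  obtain ⟨b, c, hn, -, hb, hc⟩ := h.exists_isNbrs_mate v
  refine ⟨fun hw => ?_, ?_⟩
  · rcases (hn.adj_iff w).1 hw with rfl | rfl | rfl <;> simp [*]
  · rintro (rfl | h')
    · exact hn.adj₁
    · exact h'.1

lemma mate_mate (h : G.HasType 0 1 1) (v : V) : h.mate (h.mate v) = v :=
  (h.adj_iff.1 (h.adj_mate v).symm).elim Eq.symm fun hc =>
    (h.not_oneGraph_adj_mate v hc.symm).elim

lemma sym2_mate_eq_iff (h : G.HasType 0 1 1) {v w : V} :
    s(v, h.mate v) = s(w, h.mate w) ↔ v = w ∨ w = h.mate v := by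
  rw [Sym2.eq_iff]
  constructor
  · rintro (⟨rfl, -⟩ | ⟨-, rfl⟩) <;> simp
  · rintro (rfl | rfl) <;> simp [h.mate_mate]

lemma oneGraph_neighborSet (h : G.HasType 0 1 1) (v : V) :
    (G.oneGraph.neighborSet v).encard = 2 := by
  obtain ⟨b, c, hn, -, hb, hc⟩ := h.exists_isNbrs_mate v
  rw [← Set.encard_pair hn.ne₂₃]
  congr 1
  ext x
  simp only [mem_neighborSet, Set.mem_insert_iff, Set.mem_singleton_iff]
  refine ⟨fun hx => ?_, ?_⟩
  · rcases (hn.adj_iff x).1 hx.1 with rfl | e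
    · exact absurd hx (h.not_oneGraph_adj_mate v)
    · exact e
  · rintro (rfl | rfl) <;> assumption

lemma eq_or_eq_of_oneGraph_adj (h : G.HasType 0 1 1) {v x y z : V} (hx : G.oneGraph.Adj v x)
    (hy : G.oneGraph.Adj v y) (hxy : x ≠ y) (hz : G.oneGraph.Adj v z) : z = x ∨ z = y := by
  obtain ⟨b, c, hn, -, hb, hc⟩ := h.exists_isNbrs_mate v
  have key : ∀ w, G.oneGraph.Adj v w → w = b ∨ w = c := fun w hw =>
    ((hn.adj_iff w).1 hw.1).resolve_left fun e => h.not_oneGraph_adj_mate v (e ▸ hw)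
  have h1 := key x hx
  have h2 := key y hy
  have h3 := key z hz
  grind

lemma oneGraph_adj_of_pentCount_pos (hG : G.IsCubicNoShort) (hgirth : G.girth = 5)
    (h : G.HasType 0 1 1) {x v y : V} (hx : G.Adj x v) (hy : G.Adj v y) (hxy : x ≠ y)
    (hpos : 0 < G.pentCount x v y) : G.oneGraph.Adj v y := by
  refine ⟨hy, ?_⟩
  obtain ⟨c, hn⟩ := hG.nbrs_of_adj₂ hx.symm hy hxy
  have e := hG.girthCycleCount_eqs hgirth hn
  obtain ⟨a, b, c, hn', e1, e2, e3⟩ := h v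
  rcases (hn'.adj_iff y).1 hy with rfl | rfl | rfl
  · omega
  · exact e2
  · exact e3

/-- Every vertex lies in a pentagon all of whose edges lie in no other pentagon. -/
lemma exists_pentagon (hG : G.IsCubicNoShort) (hgirth : G.girth = 5) (h : G.HasType 0 1 1)
    (u : V) : ∃ c p w b, G.oneGraph.Adj u c ∧ G.oneGraph.Adj c p ∧ G.oneGraph.Adj p w ∧
      G.oneGraph.Adj w b ∧ G.oneGraph.Adj b u ∧ [u, c, p, w, b].Nodup := by
  obtain ⟨b, c, hn, h0, hb, hc⟩ := h.exists_isNbrs_mate u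
  have hpos : 0 < G.pentCount b u c := by
    have e := hG.girthCycleCount_eqs hgirth hn
    have := hb.2
    omega
  obtain ⟨p, hp, hpu, w, hw, hw'⟩ := exists_of_pentCount_pos hpos
  have hub := hn.adj₂
  have huc := hn.adj₃
  have hwu : w ≠ u := by rintro rfl; exact hG.not_adj_of_path huc hp hw'
  have hwc : w ≠ c := by rintro rfl; exact hG.not_adj_of_path hub hw.symm huc
  have hbp : b ≠ p := by rintro rfl; exact hG.not_adj_of_path huc hp hub
  refine ⟨c, p, w, b, hc, ?_, ?_, ?_, hb.symm, ?_⟩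
  · exact h.oneGraph_adj_of_pentCount_pos hG hgirth huc hp hpu.symm
      (hG.pentCount_pos hw'.symm hwc ⟨b, hub.symm, hw.symm⟩)
  · exact h.oneGraph_adj_of_pentCount_pos hG hgirth hp hw'.symm hwc.symm
      (hG.pentCount_pos hw hbp ⟨u, huc, hub⟩)
  · exact h.oneGraph_adj_of_pentCount_pos hG hgirth hw'.symm hw hbp.symm
      (hG.pentCount_pos hub.symm hwu.symm ⟨c, hp, huc.symm⟩)
  · have := huc.ne
    have := hp.ne
    have := hw'.ne
    have := hw.ne
    have := hub.ne
    have := hn.ne₂₃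
    simp only [List.nodup_cons, List.mem_cons, List.not_mem_nil, or_false, not_or, List.nodup_nil]
    grind

/-- Every vertex has only two neighbours in `oneGraph`, and on the pentagon both are on the
pentagon, so no walk leaves it. -/
lemma supp_connectedComponent (h : G.HasType 0 1 1) {u c p w b : V}
    (huc : G.oneGraph.Adj u c) (hcp : G.oneGraph.Adj c p) (hpw : G.oneGraph.Adj p w)
    (hwb : G.oneGraph.Adj w b) (hbu : G.oneGraph.Adj b u) (hd : [u, c, p, w, b].Nodup) :
    (G.oneGraph.connectedComponentMk u).supp = {u, c, p, w, b} := by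
  simp only [List.nodup_cons, List.mem_cons, List.not_mem_nil, or_false, not_or] at hd
  ext x
  rw [ConnectedComponent.mem_supp_iff, ConnectedComponent.eq]
  constructor
  · rintro ⟨q⟩
    have hmem : ∀ {x y}, G.oneGraph.Walk x y → y ∈ ({u, c, p, w, b} : Set V) →
        x ∈ ({u, c, p, w, b} : Set V) := by
      intro x y q hy
      induction q with
      | nil => exact hy
      | cons hadj _ ih =>
        simp only [Set.mem_insert_iff, Set.mem_singleton_iff] at ih ⊢
        rcases ih hy with rfl | rfl | rfl | rfl | rfl
        · have := h.eq_or_eq_of_oneGraph_adj huc hbu.symm (by tauto) hadj.symm; tauto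
        · have := h.eq_or_eq_of_oneGraph_adj huc.symm hcp (by tauto) hadj.symm; tauto
        · have := h.eq_or_eq_of_oneGraph_adj hcp.symm hpw (by tauto) hadj.symm; tauto
        · have := h.eq_or_eq_of_oneGraph_adj hpw.symm hwb (by tauto) hadj.symm; tauto
        · have := h.eq_or_eq_of_oneGraph_adj hwb.symm hbu (by tauto) hadj.symm; tauto
    exact hmem q (by simp)
  · have h1 := hbu.reachable
    have h2 := hwb.reachable.trans h1
    have h3 := hpw.reachable.trans h2
    rintro (rfl | rfl | rfl | rfl | rfl)
    · rfl
    · exact huc.symm.reachable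
    · exact h3
    · exact h2
    · exact h1

lemma encard_supp (hG : G.IsCubicNoShort) (hgirth : G.girth = 5) (h : G.HasType 0 1 1)
    (X : G.oneGraph.ConnectedComponent) : X.supp.encard = 5 := by
  induction X using ConnectedComponent.ind with
  | h u =>
    obtain ⟨c, p, w, b, huc, hcp, hpw, hwb, hbu, hd⟩ := h.exists_pentagon hG hgirth u
    classical
    rw [h.supp_connectedComponent huc hcp hpw hwb hbu hd]
    have : ({u, c, p, w, b} : Set V) = ([u, c, p, w, b].toFinset : Set V) := by
      ext; simp
    rw [this, Set.encard_coe_eq_coe_finsetCard, List.toFinset_card_of_nodup hd]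
    rfl

/-- A mate on the same pentagon would be joined by a pentagon edge, whose count is 1 and not 0, or
would lie two steps away and close a triangle. -/
lemma connectedComponentMk_mate_ne (hG : G.IsCubicNoShort) (hgirth : G.girth = 5)
    (h : G.HasType 0 1 1) (u : V) :
    G.oneGraph.connectedComponentMk u ≠ G.oneGraph.connectedComponentMk (h.mate u) := by
  intro e
  obtain ⟨c, p, w, b, huc, hcp, hpw, hwb, hbu, hd⟩ := h.exists_pentagon hG hgirth u
  have hm : h.mate u ∈ (G.oneGraph.connectedComponentMk u).supp :=
    (ConnectedComponent.mem_supp_iff _ _).2 e.symm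
  rw [h.supp_connectedComponent huc hcp hpw hwb hbu hd] at hm
  have h1 := h.adj_mate u
  have h2 := h.not_oneGraph_adj_mate u
  rcases hm with e | e | e | e | e <;> rw [e] at h1 h2
  · exact h1.ne rfl
  · exact h2 huc
  · exact hG.not_adj_of_path huc.1 hcp.1 h1
  · exact hG.not_adj_of_path hbu.1.symm hwb.1.symm h1
  · exact h2 hbu.symm

/-- The multigraph whose vertices are the pentagons and whose edges are the edges of `G` in no
pentagon. -/
noncomputable def pentagonGraph (h : G.HasType 0 1 1) :
    Graph G.oneGraph.ConnectedComponent (Sym2 V) where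
  vertexSet := Set.univ
  IsLink e X Y := ∃ v, e = s(v, h.mate v) ∧ X = G.oneGraph.connectedComponentMk v ∧
    Y = G.oneGraph.connectedComponentMk (h.mate v)
  isLink_symm := by
    rintro e -
    constructor
    rintro _ _ ⟨v, rfl, rfl, rfl⟩
    exact ⟨h.mate v, by rw [h.mate_mate, Sym2.eq_swap], rfl, by rw [h.mate_mate]⟩
  eq_or_eq_of_isLink_of_isLink := by
    rintro e _ _ _ _ ⟨v, rfl, rfl, rfl⟩ ⟨w, he, rfl, rfl⟩
    rcases h.sym2_mate_eq_iff.1 he with rfl | rfl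
    · exact .inl rfl
    · exact .inr (by rw [h.mate_mate])
  left_mem_of_isLink := by simp

lemma pentagonGraph_loopless (hG : G.IsCubicNoShort) (hgirth : G.girth = 5)
    (h : G.HasType 0 1 1) : h.pentagonGraph.Loopless where
  not_isLoopAt e X := by
    rintro ⟨v, rfl, e1, e2⟩
    exact h.connectedComponentMk_mate_ne hG hgirth v (e1.symm.trans e2)

/-- The arc corresponding to a vertex of `G`. -/
noncomputable def toArc (h : G.HasType 0 1 1) [h.pentagonGraph.Loopless] (v : V) :
    h.pentagonGraph.Arc :=
  ⟨G.oneGraph.connectedComponentMk v, s(v, h.mate v), _, v, rfl, rfl, rfl⟩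

/-- An edge in no pentagon has only the ends `v` and `h.mate v`; they lie on different pentagons, so
the tail tells them apart. -/
lemma toArc_bijective (hG : G.IsCubicNoShort) (hgirth : G.girth = 5) (h : G.HasType 0 1 1)
    [h.pentagonGraph.Loopless] : h.toArc.Bijective := by
  constructor
  · intro v w e
    obtain ⟨e1, e2⟩ := Graph.Arc.mk.inj e
    rcases h.sym2_mate_eq_iff.1 e2 with e3 | rfl
    · exact e3
    · exact absurd e1 (h.connectedComponentMk_mate_ne hG hgirth v)
  · rintro ⟨_, _, _, v, rfl, rfl, rfl⟩
    exact ⟨v, rfl⟩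

/-- The scheme is `oneGraph` carried over to the arcs by `toArc`, and inverse arcs are mates. The
valence is the number of vertices of a pentagon. -/
lemma isTruncationOfRegular [Finite V] (hG : G.IsCubicNoShort) (hgirth : G.girth = 5)
    (h : G.HasType 0 1 1) : G.IsTruncationOfRegular 5 := by
  have hl := h.pentagonGraph_loopless hG hgirth
  let φ : V ≃ h.pentagonGraph.Arc := .ofBijective h.toArc (h.toArc_bijective hG hgirth)
  have htail : ∀ s, s.tail = G.oneGraph.connectedComponentMk (φ.symm s) := fun s => by
    obtain ⟨v, rfl⟩ := φ.surjective s
    rw [φ.symm_apply_apply]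
    rfl
  let H : SimpleGraph h.pentagonGraph.Arc := G.oneGraph.comap φ.symm
  let ψ : H ≃g G.oneGraph := ⟨φ.symm, Iff.rfl⟩
  let D : h.pentagonGraph.DihedralScheme :=
    { rel := H
      two_regular := fun s => by
        rw [← h.oneGraph_neighborSet (φ.symm s), ← φ.symm.injective.encard_image]
        congr 1
        ext x
        simp only [Set.mem_image, mem_neighborSet]
        constructor
        · rintro ⟨t, ht, rfl⟩
          exact ht
        · intro hx
          exact ⟨φ x, by simpa [H] using hx, by simp⟩
      component_eq_out := fun c => by
        induction c using ConnectedComponent.ind with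
        | h s =>
          refine ⟨s.tail, Set.mem_univ _, ?_⟩
          ext t
          rw [ConnectedComponent.mem_supp_iff, ConnectedComponent.eq, ← ψ.reachable_iff]
          change _ ↔ t.tail = s.tail
          rw [htail, htail, ConnectedComponent.eq]
          rfl }
  refine ⟨_, _, h.pentagonGraph, hl, D, Set.toFinite _, Set.toFinite _, ?_, ⟨⟨φ, ?_⟩⟩⟩
  · intro X _
    rw [show ((5 : ℕ) : ℕ∞) = 5 from rfl, ← h.encard_supp hG hgirth X,
      ← φ.symm.injective.encard_image]
    congr 1
    ext v
    simp only [Set.mem_image, ConnectedComponent.mem_supp_iff]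
    constructor
    · rintro ⟨s, hs, rfl⟩
      exact (htail s).symm.trans hs
    · intro hv
      exact ⟨φ v, hv, by simp⟩
  · intro a b
    change H.Adj (φ a) (φ b) ∨ (s(a, h.mate a) = s(b, h.mate b) ∧
      G.oneGraph.connectedComponentMk a ≠ G.oneGraph.connectedComponentMk b) ↔ G.Adj a b
    rw [h.adj_iff, h.sym2_mate_eq_iff]
    have hH : H.Adj (φ a) (φ b) ↔ G.oneGraph.Adj a b := by simp [H]
    rw [hH, or_comm]
    refine or_congr_left ⟨?_, ?_⟩
    · rintro ⟨rfl | e, hne⟩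
      · exact absurd rfl hne
      · exact e
    · rintro rfl
      exact ⟨.inr rfl, h.connectedComponentMk_mate_ne hG hgirth a⟩

end HasType
end SimpleGraph

/-! ### Assembly of the ten cases -/

theorem mainTheorem8 {V : Type u} [Fintype V] [DecidableEq V]
    (G : SimpleGraph V) [DecidableRel G.Adj]
    (hconn : G.Connected) (hcubic : G.IsRegularOfDegree 3)
    (hreg : G.IsGirthRegular) (hgirth : G.girth = 5) :
    ((G.HasSignature [0, 1, 1] ∧ G.IsTruncationOfRegular 5) ∨
      Nonempty (G ≃g SimpleGraph.petersenGraph) ∨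
      Nonempty (G ≃g SimpleGraph.dodecahedronGraph)) ∧
    ¬ G.HasSignature [2, 3, 3] ∧
    ∀ a b c : ℕ, G.HasSignature [a, b, c] → c ≠ 3 := by
  have hG := SimpleGraph.isCubicNoShort_of_girth hcubic hgirth
  have hne := hconn.nonempty
  obtain ⟨α, β, γ, h1, h2, hs⟩ := SimpleGraph.exists_hasSignature hG hreg
  have ht := hs.hasType hG
  have hcases := ht.cases hG hgirth h1 h2
  have huniq : ∀ a b c : ℕ, G.HasSignature [a, b, c] → (a, b, c) = (α, β, γ) := by
    intro a b c h
    obtain ⟨v⟩ := hne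
    have := (h v).symm.trans (hs v)
    simpa using this
  simp only [List.mem_cons, Prod.mk.injEq, List.not_mem_nil, or_false] at hcases
  rcases hcases with ⟨rfl, rfl, rfl⟩ | ⟨rfl, rfl, rfl⟩ | ⟨rfl, rfl, rfl⟩ | ⟨rfl, rfl, rfl⟩ |
    ⟨rfl, rfl, rfl⟩ | ⟨rfl, rfl, rfl⟩ | ⟨rfl, rfl, rfl⟩ | ⟨rfl, rfl, rfl⟩ | ⟨rfl, rfl, rfl⟩ |
    ⟨rfl, rfl, rfl⟩
  · exact absurd ht (SimpleGraph.not_hasType_zero hG hgirth)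
  · refine ⟨.inl ⟨hs, ht.isTruncationOfRegular hG hgirth⟩, fun h => ?_, fun a b c h => ?_⟩ <;>
      have := huniq _ _ _ h <;> grind
  · exact absurd ht (SimpleGraph.not_hasType_zero_two_two hG hgirth)
  · exact absurd ht (SimpleGraph.not_hasType_one_one_two hG hgirth)
  · exact absurd ht (SimpleGraph.not_hasType_one_two_three hG hgirth)
  · refine ⟨.inr (.inl (hG.nonempty_iso_petersen_of_type hgirth hconn ht)), fun h => ?_,
      fun a b c h => ?_⟩ <;> have := huniq _ _ _ h <;> grind
  · refine ⟨.inr (.inr (hG.nonempty_iso_dodecahedron hconn (ht.uniquePentagon hG hgirth))),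
      fun h => ?_, fun a b c h => ?_⟩ <;> have := huniq _ _ _ h <;> grind
  · exact absurd ht (SimpleGraph.not_hasType_two_three_three hG hgirth)
  · refine ⟨.inr (.inl (hG.nonempty_iso_petersen_of_type hgirth hconn ht)), fun h => ?_,
      fun a b c h => ?_⟩ <;> have := huniq _ _ _ h <;> grind
  · refine ⟨.inr (.inl (hG.nonempty_iso_petersen_of_type hgirth hconn ht)), fun h => ?_,
      fun a b c h => ?_⟩ <;> have := huniq _ _ _ h <;> grind
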